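/- **Theorem 2.4 (Bayesian–Sanov theorem for Pólya sampling).** Let $\mathcal X$ be a finite set, let $\mathcal P(\mathcal X)$ be the set of probability mass functions on $\mathcal X$ with $q_i>0$ for all $i\in\mathcal X$, regarded as a subset of the probability simplex with its usual topology, let $c\in\mathbb Z$ and $\beta\in(0,1)$. *Urn.* For a configuration $\alpha\in\mathbb Z_{\ge 0}^{\mathcal X}$ of $N=\sum_i\alpha_i$ balls, an ordered sample $x$ of size $n$ in which colour $i$ occurs $n_i$ times is drawn from the Pólya urn with parameter $c$ with probability $$\Pi(x\mid\alpha;c)=\frac{\prod_{i\in\mathcal X}\prod_{l=0}^{n_i-1}(\alpha_i+lc)}{\prod_{l=0}^{n-1}(N+lc)} ;$$ this is meaningful if $-nc\le\min_i\alpha_i$. For a subset $A$ of the simplex, let $A(N)$ be the set of configurations $\alpha$ of $N$ balls with $\alpha/N\in A$. *Divergence.* For $p,q\in\mathcal P(\mathcal X)$ put, for $c\ne0$, $$L^c_\beta(q\|p)=-\sum_i p_i\log(q_i+\beta c p_i)+\frac1{\beta c}\sum_i q_i\log\frac{q_i}{q_i+\beta c p_i},\qquad L^0_\beta(q\|p)=-\sum_i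 p_i\log q_i-1,$$ and $L^c_\beta(A\|p)=\inf_{q\in A}L^c_\beta(q\|p)$ (with $\inf\emptyset=\infty$). *Setting.* Let $Q\subseteq\Phi\subseteq\mathcal P(\mathcal X)$ be open, and let $N=N(n)$ satisfy $n/N(n)\to\beta$ as $n\to\infty$. For each $n$ let $r(N)$ be (the vector of proportions of) the true initial configuration of $N(n)$ balls, and let $r(N)\to r\in\mathcal P(\mathcal X)$ in total variation. Assume that for all large $n$ sampling $n$ balls is meaningful for the true configuration and for every configuration in $\Phi(N)$. For each $n$ let $\pi_n$ be a prior distribution of the initial configuration whose support is $\Phi(N(n))$ for all large $n$, and assume that it is not exponentially small on any open set: for every nonempty open $G\subseteq\Phi$ and every $\varepsilon>0$, $\pi_n(G(N(n)))\ge e^{-\varepsilon n}$ for all large $n$. (The uniform prior on $\Phi(N)$ is an example.) Let $X_1^n$, $n\ge1$, be samples on one probability space such that, for all large $n$, $X_1^n$ is a sample of size $n$ from the Pólya urn with the true initial configuration of $N(n)$ balls; the joint distribution of the samples for different $n$ is arbitrary. The posterior is $$\Pi_n(Q\mid X_1^n)=\frac{\sum_{\alpha\in Q(N)}\pi_n(\alpha)\,\Pi(X_1^n\mid\alpha;c)}{\sum_{\alpha\in\Phi(N)}\pi_n(\alpha)\,\Pi(X_1^n\mid\alpha;c)}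 .$$ *Claim.* If $L^c_\beta(Q\|r)<\infty$, then with probability one $\Pi_n(Q\mid X_1^n)>0$ for all large $n$ and $$\lim_{n\to\infty}\frac1n\log\Pi_n(Q\mid X_1^n)=-\bigl(L^c_\beta(Q\|r)-L^c_\beta(\Phi\|r)\bigr).$$ -/

import Mathlib

open Filter Topology MeasureTheory

namespace PolyaUrn

noncomputable section

variable {𝒳 : Type*} [Fintype 𝒳] [DecidableEq 𝒳]

/-- The probability mass functions on `𝒳` whose support is all of `𝒳`, as a subset of the
probability simplex. -/
def fullSupport (𝒳 : Type*) [Fintype 𝒳] : Set (stdSimplex ℝ 𝒳) :=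
  {q | ∀ i, 0 < (q : 𝒳 → ℝ) i}

/-- `configs A N`: the configurations `α` (numbers of balls of each colour) of an urn with `N`
balls such that the vector of proportions `α / N` belongs to `A`. -/
def configs (A : Set (stdSimplex ℝ 𝒳)) (N : ℕ) : Finset (𝒳 → ℕ) := by
  classical
  exact (Finset.piAntidiag Finset.univ N).filter
    (fun α => ∃ q ∈ A, ∀ i, (q : 𝒳 → ℝ) i = (α i : ℝ) / N)

/-- The number of occurrences of the colour `i` in the sample `x`. -/
def count {n : ℕ} (x : Fin n → 𝒳) (i : 𝒳) : ℕ :=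
  (Finset.univ.filter (fun k => x k = i)).card

/-- The probability of drawing the ordered sample `x` from a Pólya urn with initial
configuration `α` and parameter `c` (after each draw the ball is put back together with `c`
further balls of its colour; `c < 0` means removal). -/
def sampleProb (c : ℤ) (α : 𝒳 → ℕ) {n : ℕ} (x : Fin n → 𝒳) : ℝ :=
  (∏ i, ∏ l ∈ Finset.range (count x i), ((α i : ℝ) + l * c)) /
    ∏ l ∈ Finset.range n, ((∑ i, (α i : ℝ)) + l * c)

/-- The sampling of `n` balls from the configuration `α` is meaningful: `-n c ≤ min α`. -/
def Meaningful (c : ℤ) (n : ℕ) (α : 𝒳 → ℕ) : Prop :=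
  ∀ i, -((n : ℤ) * c) ≤ (α i : ℤ)

/-- Prior probability that the proportions of the `N`-urn lie in `A`. -/
def priorMass (π : PMF (𝒳 → ℕ)) (N : ℕ) (A : Set (stdSimplex ℝ 𝒳)) : ℝ :=
  ∑ α ∈ configs A N, (π α).toReal

/-- Posterior probability that the initial proportions of the `N`-urn lie in `Q`, given the
sample `x`, for a prior `π` with support `configs Φ N`. -/
def posterior (c : ℤ) (π : PMF (𝒳 → ℕ)) (N : ℕ) (Φ Q : Set (stdSimplex ℝ 𝒳))
    {n : ℕ} (x : Fin n → 𝒳) : ℝ :=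
  (∑ α ∈ configs Q N, (π α).toReal * sampleProb c α x) /
    ∑ α ∈ configs Φ N, (π α).toReal * sampleProb c α x

/-- The Pólya `L`-divergence of `q` with respect to `p`. -/
def polyaL (β : ℝ) (c : ℤ) (q p : stdSimplex ℝ 𝒳) : ℝ :=
  if c = 0 then
    -(∑ i, (p : 𝒳 → ℝ) i * Real.log ((q : 𝒳 → ℝ) i)) - 1
  else
    -(∑ i, (p : 𝒳 → ℝ) i * Real.log ((q : 𝒳 → ℝ) i + β * c * (p : 𝒳 → ℝ) i)) +
      1 / (β * c) * ∑ i, (q : 𝒳 → ℝ) i *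
        Real.log ((q : 𝒳 → ℝ) i / ((q : 𝒳 → ℝ) i + β * c * (p : 𝒳 → ℝ) i))

/-- The value of the divergence of a set `A`, i.e. the infimum of `polyaL β c q p` over
`q ∈ A`, as an extended real (`⊤` for the empty set). -/
def polyaLSet (β : ℝ) (c : ℤ) (A : Set (stdSimplex ℝ 𝒳)) (p : stdSimplex ℝ 𝒳) : EReal :=
  ⨅ q ∈ A, (polyaL β c q p : EReal)

end

end PolyaUrn


/-!
By Azuma's argument for the urn martingale the deviations of the sample frequencies have
exponentially small probability, so by Borel–Cantelli the frequencies converge to `r` almost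
surely, whatever the joint law of the samples. Along such a sequence of samples, the likelihood of
a configuration `α` is a factor common to all configurations times `exp (n * logLik)`, where
`logLik` is a sum of logarithms along arithmetic progressions. Comparing these sums with the
primitive of `log` shows that `logLik` is asymptotically `-L - 1`, `L` being the divergence
between `α / N` and `r`. Since the prior is not exponentially small on open sets, Laplace's
principle turns the numerator and the denominator of the posterior into the suprema of this rate
over `Q` and over `Φ`.
-/

namespace PolyaUrn

/-! ### Sums of logarithms along an arithmetic progression -/

/-- The antiderivative `x log x - x` of the logarithm, which extends continuously to `0`; it
approximates sums of logarithms by a closed form. -/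
noncomputable def logPrimitive (x : ℝ) : ℝ := x * Real.log x - x

lemma continuous_logPrimitive : Continuous logPrimitive :=
  Real.continuous_mul_log.sub continuous_id

lemma sub_mul_log_le_logPrimitive_sub {x y : ℝ} (hx : 0 < x) (hy : 0 < y) :
    (y - x) * Real.log x ≤ logPrimitive y - logPrimitive x := by
  have hlog : Real.log x - Real.log y ≤ x / y - 1 := by
    rw [← Real.log_div hx.ne' hy.ne']
    exact Real.log_le_sub_one_of_pos (div_pos hx hy)
  have hmul : y * (Real.log x - Real.log y) ≤ x - y := by
    calc y * (Real.log x - Real.log y) ≤ y * (x / y - 1) := by gcongr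
      _ = x - y := by field_simp
  unfold logPrimitive
  linarith

lemma logPrimitive_mul {a u : ℝ} (ha : a ≠ 0) :
    logPrimitive (a * u) = a * logPrimitive u + a * u * Real.log a := by
  unfold logPrimitive
  rcases eq_or_ne u 0 with rfl | hu
  · simp
  · rw [Real.log_mul ha hu]
    ring

lemma mul_sum_log_le_logPrimitive_sub {a c : ℝ} {m : ℕ} (h : ∀ l ≤ m, 0 < a + (l : ℕ) * c) :
    c * ∑ l ∈ Finset.range m, Real.log (a + l * c) ≤
      logPrimitive (a + m * c) - logPrimitive a := by
  calc c * ∑ l ∈ Finset.range m, Real.log (a + l * c)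
      ≤ ∑ l ∈ Finset.range m,
          (logPrimitive (a + (l + 1 : ℕ) * c) - logPrimitive (a + l * c)) := by
        rw [Finset.mul_sum]
        refine Finset.sum_le_sum fun l hl => ?_
        have hl' := Finset.mem_range.1 hl
        have hstep := sub_mul_log_le_logPrimitive_sub (h l hl'.le) (h (l + 1) hl')
        have hdiff : a + (l + 1 : ℕ) * c - (a + l * c) = c := by push_cast; ring
        rwa [hdiff] at hstep
    _ = logPrimitive (a + m * c) - logPrimitive a := by
        rw [Finset.sum_range_sub fun l : ℕ => logPrimitive (a + l * c)]
        simp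

lemma logPrimitive_sub_le_mul_sum_log {a c : ℝ} {m : ℕ} (h : ∀ l ≤ m, 0 < a + (l : ℕ) * c) :
    logPrimitive (a + m * c) - logPrimitive a ≤
      c * ∑ l ∈ Finset.range m, Real.log (a + l * c) +
        c * (Real.log (a + m * c) - Real.log a) := by
  calc logPrimitive (a + m * c) - logPrimitive a
      = ∑ l ∈ Finset.range m,
          (logPrimitive (a + (l + 1 : ℕ) * c) - logPrimitive (a + l * c)) := by
        rw [Finset.sum_range_sub fun l : ℕ => logPrimitive (a + l * c)]
        simp
    _ ≤ ∑ l ∈ Finset.range m, c * Real.log (a + (l + 1 : ℕ) * c) := by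
        refine Finset.sum_le_sum fun l hl => ?_
        have hl' := Finset.mem_range.1 hl
        have hstep := sub_mul_log_le_logPrimitive_sub (h (l + 1) hl') (h l hl'.le)
        have hdiff : a + l * c - (a + (l + 1 : ℕ) * c) = -c := by push_cast; ring
        rw [hdiff] at hstep
        linarith
    _ = c * ∑ l ∈ Finset.range m, Real.log (a + l * c) +
          c * (Real.log (a + m * c) - Real.log a) := by
        have hshift := (Finset.sum_range_succ' (fun l : ℕ => Real.log (a + l * c)) m).symm.trans
          (Finset.sum_range_succ _ m)
        simp only [Nat.cast_zero, zero_mul, add_zero] at hshift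
        rw [← Finset.mul_sum, ← mul_add]
        congr 1
        linarith

lemma abs_logPrimitive_sub_sub_mul_sum_log_le {a c B : ℝ} {m : ℕ}
    (ha : 1 ≤ a) (hm : 1 ≤ a + m * c) (haB : a ≤ B) (hmB : a + m * c ≤ B) :
    |logPrimitive (a + m * c) - logPrimitive a - c * ∑ l ∈ Finset.range m, Real.log (a + l * c)|
      ≤ |c| * Real.log B := by
  have hpos : ∀ l ≤ m, 0 < a + (l : ℕ) * c := fun l hl => by
    have hl' : (l : ℝ) ≤ m := Nat.cast_le.2 hl
    rcases le_total 0 c with hc | hc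
    · positivity
    · linarith [mul_le_mul_of_nonpos_right hl' hc]
  have hlower := mul_sum_log_le_logPrimitive_sub hpos
  have hupper := logPrimitive_sub_le_mul_sum_log hpos
  rw [abs_of_nonneg (sub_nonneg.2 hlower)]
  calc _ ≤ c * (Real.log (a + m * c) - Real.log a) := by linarith
    _ ≤ |c| * |Real.log (a + m * c) - Real.log a| := (le_abs_self _).trans_eq (abs_mul _ _)
    _ ≤ |c| * Real.log B := by
        gcongr
        have := Real.log_nonneg ha
        have := Real.log_nonneg hm
        have := Real.log_le_log (by linarith) haB
        have := Real.log_le_log (hpos m le_rfl) hmB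
        rw [abs_le]
        constructor <;> linarith

lemma tendsto_log_div_natCast {y : ℕ → ℝ} {b : ℝ} (hb : 0 < b)
    (hy : Tendsto (fun n => y n / (n : ℝ)) atTop (𝓝 b)) :
    Tendsto (fun n => Real.log (y n) / (n : ℝ)) atTop (𝓝 0) := by
  have hy_top : Tendsto y atTop atTop := by
    refine (hy.pos_mul_atTop hb tendsto_natCast_atTop_atTop).congr' ?_
    filter_upwards [eventually_ne_atTop 0] with n hn
    exact div_mul_cancel₀ _ (Nat.cast_ne_zero.2 hn)
  have hprod := (Real.isLittleO_log_id_atTop.tendsto_div_nhds_zero.comp hy_top).mul hy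
  rw [zero_mul] at hprod
  refine hprod.congr' ?_
  filter_upwards [hy_top.eventually_ne_atTop 0] with n hn
  exact div_mul_div_cancel₀ hn

lemma eventually_pos_of_tendsto_div {β : ℝ} (hβ : 0 < β) {N : ℕ → ℕ}
    (hN : Tendsto (fun n : ℕ => (n : ℝ) / (N n : ℝ)) atTop (𝓝 β)) :
    ∀ᶠ n in atTop, 0 < N n := by
  filter_upwards [hN.eventually_const_lt hβ] with n hn
  refine Nat.pos_of_ne_zero fun h => ?_
  simp [h] at hn

lemma tendsto_log_add_div {β : ℝ} (hβ : 0 < β) {N : ℕ → ℕ}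
    (hN : Tendsto (fun n : ℕ => (n : ℝ) / (N n : ℝ)) atTop (𝓝 β)) {d : ℝ} (hd : 0 ≤ d) :
    Tendsto (fun n : ℕ => Real.log (N n + n * d) / n) atTop (𝓝 0) := by
  refine tendsto_log_div_natCast (b := β⁻¹ + d) (by positivity) ?_
  refine ((hN.inv₀ hβ.ne').add_const d).congr' ?_
  filter_upwards [eventually_ne_atTop 0] with n hn
  have : (n : ℝ) ≠ 0 := Nat.cast_ne_zero.2 hn
  field_simp

/-! ### Configurations and sample probabilities -/

section Configurations

variable {𝒳 : Type*}

lemma Meaningful.mono {c : ℤ} {m n : ℕ} {α : 𝒳 → ℕ} (h : Meaningful c n α) (hmn : m ≤ n) :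
    Meaningful c m α := by
  intro i
  have hi := h i
  have : (m : ℤ) ≤ n := by exact_mod_cast hmn
  rcases le_or_gt 0 c with hc | hc
  · have : 0 ≤ (m : ℤ) * c := by positivity
    lia
  · nlinarith

lemma Meaningful.nonneg {c : ℤ} {n : ℕ} {α : 𝒳 → ℕ} (h : Meaningful c n α) (i : 𝒳) :
    (0 : ℝ) ≤ (α i : ℝ) + n * c := by
  have : (0 : ℤ) ≤ (α i : ℤ) + n * c := by linarith [h i]
  exact_mod_cast this

lemma Meaningful.one_le {c : ℤ} {n : ℕ} {α : 𝒳 → ℕ} (h : Meaningful c n α) {i : 𝒳}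
    (hα : 0 < α i) {l : ℕ} (hl : l < n) : (1 : ℝ) ≤ (α i : ℝ) + l * c := by
  have hi := h.mono (Nat.succ_le_of_lt hl) i
  have : (1 : ℤ) ≤ (α i : ℤ) + l * c := by
    rcases le_or_gt 0 c with hc | hc
    · have : 0 ≤ (l : ℤ) * c := by positivity
      lia
    · push_cast at hi
      linarith
  exact_mod_cast this

lemma count_le [DecidableEq 𝒳] {n : ℕ} (x : Fin n → 𝒳) (i : 𝒳) : count x i ≤ n :=
  (Finset.card_le_univ _).trans_eq (Fintype.card_fin n)

variable [Fintype 𝒳]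

lemma mem_Ioo_of_mem_fullSupport [Nontrivial 𝒳] {q : stdSimplex ℝ 𝒳} (hq : q ∈ fullSupport 𝒳)
    (i : 𝒳) : q i ∈ Set.Ioo 0 1 := by
  obtain ⟨j, hji⟩ := exists_ne i
  have hpair := Finset.add_le_sum (fun k _ => stdSimplex.zero_le q k) (Finset.mem_univ i)
    (Finset.mem_univ j) hji.symm
  rw [stdSimplex.sum_eq_one] at hpair
  have hj : 0 < q j := hq j
  exact ⟨hq i, by linarith⟩

lemma le_sum_cast (α : 𝒳 → ℕ) (i : 𝒳) : (α i : ℝ) ≤ ∑ j, (α j : ℝ) :=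
  Finset.single_le_sum (f := fun j => (α j : ℝ)) (fun _ _ => Nat.cast_nonneg _)
    (Finset.mem_univ i)

lemma Meaningful.half_sum_le [Nontrivial 𝒳] {c : ℤ} {n : ℕ} {α : 𝒳 → ℕ}
    (h : Meaningful c n α) : (∑ i, (α i : ℝ)) / 2 ≤ (∑ i, (α i : ℝ)) + n * c := by
  classical
  obtain ⟨i, j, hij⟩ := exists_pair_ne 𝒳
  have hpair : (α i : ℝ) + α j ≤ ∑ k, (α k : ℝ) := by
    rw [← Finset.sum_pair (f := fun k => (α k : ℝ)) hij]
    exact Finset.sum_le_sum_of_subset_of_nonneg (Finset.subset_univ _) fun _ _ _ => by positivity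
  linarith [h.nonneg i, h.nonneg j]

variable [DecidableEq 𝒳]

lemma sum_count {n : ℕ} (x : Fin n → 𝒳) : ∑ i, count x i = n := by
  simp [count, Finset.sum_card_fiberwise_eq_card_filter]

lemma sampleProb_nonneg {c : ℤ} {n : ℕ} {α : 𝒳 → ℕ} (h : Meaningful c n α) (x : Fin n → 𝒳) :
    0 ≤ sampleProb c α x := by
  refine div_nonneg (Finset.prod_nonneg fun i _ => Finset.prod_nonneg fun l hl => ?_)
    (Finset.prod_nonneg fun l hl => ?_)
  · exact (h.mono ((Finset.mem_range.1 hl).trans_le (count_le x i)).le).nonneg i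
  · have hl := Finset.mem_range.1 hl
    linarith [(h.mono hl.le).nonneg (x ⟨l, hl⟩), le_sum_cast α (x ⟨l, hl⟩)]

lemma sampleProb_pos {c : ℤ} {n : ℕ} {α : 𝒳 → ℕ} (h : Meaningful c n α) (hα : ∀ i, 0 < α i)
    (x : Fin n → 𝒳) : 0 < sampleProb c α x := by
  refine div_pos (Finset.prod_pos fun i _ => Finset.prod_pos fun l hl => ?_)
    (Finset.prod_pos fun l hl => ?_)
  · linarith [h.one_le (hα i) ((Finset.mem_range.1 hl).trans_le (count_le x i))]
  · have hl := Finset.mem_range.1 hl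
    linarith [h.one_le (hα (x ⟨l, hl⟩)) hl, le_sum_cast α (x ⟨l, hl⟩)]

lemma mem_configs {A : Set (stdSimplex ℝ 𝒳)} {N : ℕ} {α : 𝒳 → ℕ} :
    α ∈ configs A N ↔ ∑ i, α i = N ∧ ∃ q ∈ A, ∀ i, (q : 𝒳 → ℝ) i = (α i : ℝ) / N := by
  simp [configs]

lemma configs_mono {A B : Set (stdSimplex ℝ 𝒳)} (h : A ⊆ B) (N : ℕ) :
    configs A N ⊆ configs B N := by
  intro α hα
  obtain ⟨hsum, q, hq, hqα⟩ := mem_configs.1 hα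
  exact mem_configs.2 ⟨hsum, q, h hq, hqα⟩

lemma pos_of_mem_configs {A : Set (stdSimplex ℝ 𝒳)} (hA : A ⊆ fullSupport 𝒳) {N : ℕ}
    {α : 𝒳 → ℕ} (h : α ∈ configs A N) (i : 𝒳) : 0 < α i := by
  obtain ⟨-, q, hq, hqα⟩ := mem_configs.1 h
  have hqi := hA hq i
  rw [hqα] at hqi
  refine Nat.pos_of_ne_zero fun h0 => ?_
  simp [h0] at hqi

lemma configs_nonempty_of_priorMass_pos {π : PMF (𝒳 → ℕ)} {N : ℕ} {A : Set (stdSimplex ℝ 𝒳)}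
    (h : 0 < priorMass π N A) : (configs A N).Nonempty :=
  Finset.nonempty_of_sum_ne_zero h.ne'

lemma priorMass_le_one (π : PMF (𝒳 → ℕ)) (N : ℕ) (A : Set (stdSimplex ℝ 𝒳)) :
    priorMass π N A ≤ 1 := by
  rw [priorMass, ← ENNReal.toReal_sum fun α _ => π.apply_ne_top α]
  refine ENNReal.toReal_le_of_le_ofReal zero_le_one ?_
  rw [ENNReal.ofReal_one, ← π.tsum_coe]
  exact ENNReal.sum_le_tsum _

/-- The priors `π n` are not exponentially small (at speed `n`) on any nonempty open subset
of `A`. -/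
def NotExpSmall (π : ℕ → PMF (𝒳 → ℕ)) (N : ℕ → ℕ) (A : Set (stdSimplex ℝ 𝒳)) : Prop :=
  ∀ G ⊆ A, IsOpen G → G.Nonempty → ∀ ε : ℝ, 0 < ε →
    ∀ᶠ n : ℕ in atTop, Real.exp (-(ε * n)) ≤ priorMass (π n) (N n) G

lemma NotExpSmall.mono {π : ℕ → PMF (𝒳 → ℕ)} {N : ℕ → ℕ} {A B : Set (stdSimplex ℝ 𝒳)}
    (h : NotExpSmall π N B) (hAB : A ⊆ B) : NotExpSmall π N A :=
  fun G hG => h G (hG.trans hAB)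

lemma NotExpSmall.eventually_priorMass_pos {π : ℕ → PMF (𝒳 → ℕ)} {N : ℕ → ℕ}
    {A : Set (stdSimplex ℝ 𝒳)} (h : NotExpSmall π N A) (hAo : IsOpen A) (hA : A.Nonempty) :
    ∀ᶠ n in atTop, 0 < priorMass (π n) (N n) A := by
  filter_upwards [h A subset_rfl hAo hA 1 one_pos] with n hn
  exact (Real.exp_pos _).trans_le hn

end Configurations


/-! ### The rate of the likelihood -/

section Rate

variable {𝒳 : Type*} [Fintype 𝒳]

/-- The limit of `1/n` times the logarithm of the likelihood, up to a term which is the same for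
all initial configurations: `q` is the limit of the initial proportions, `p` that of the sample
frequencies, and `b` that of the ratio of the sample size to the size of the urn. For `c ≠ 0` it
is `-polyaL b c q p - 1` in a form that has no singularity at the boundary of the simplex. -/
noncomputable def rate (b : ℝ) (c : ℤ) (p q : 𝒳 → ℝ) : ℝ :=
  if c = 0 then ∑ i, p i * Real.log (q i)
  else (b * c)⁻¹ * ∑ i, (logPrimitive (q i + b * c * p i) - logPrimitive (q i))

/-- `1/n` times the logarithm of the probability of a sample of size `n` with colour counts `k`
from the urn `α` of `N` balls, without the denominator of that probability and normalised by
`log N`. -/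
noncomputable def logLik (c : ℤ) (N n : ℕ) (k α : 𝒳 → ℕ) : ℝ :=
  (∑ i, ∑ l ∈ Finset.range (k i), Real.log (α i + l * c)) / n - Real.log N

lemma polyaL_eq {β : ℝ} (hβ : β ≠ 0) {c : ℤ} {q p : stdSimplex ℝ 𝒳} (hq : ∀ i, 0 < q i)
    (hqp : ∀ i, 0 < q i + β * c * p i) : polyaL β c q p = -rate β c p q - 1 := by
  unfold polyaL rate
  split_ifs with hc
  · rfl
  · have hc' : (c : ℝ) ≠ 0 := Int.cast_ne_zero.2 hc
    have hterm : ∀ i, logPrimitive (q i + β * c * p i) - logPrimitive (q i) =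
        β * c * (p i * Real.log (q i + β * c * p i)) -
          q i * Real.log (q i / (q i + β * c * p i)) - β * c * p i := fun i => by
      rw [Real.log_div (hq i).ne' (hqp i).ne', logPrimitive, logPrimitive]
      ring
    rw [Finset.sum_congr rfl fun i _ => hterm i, Finset.sum_sub_distrib, Finset.sum_sub_distrib,
      ← Finset.mul_sum, ← Finset.mul_sum, stdSimplex.sum_eq_one]
    field_simp
    ring_nf

lemma rate_div {c : ℤ} (hc : c ≠ 0) {N n : ℕ} (hN : 0 < N) (hn : 0 < n) {k : 𝒳 → ℕ}
    (hk : ∑ i, k i = n) (α : 𝒳 → ℕ) :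
    rate (n / N) c (fun i => k i / n) (fun i => α i / N) =
      (n * c : ℝ)⁻¹ * ∑ i, (logPrimitive (α i + k i * c) - logPrimitive (α i)) - Real.log N := by
  have hN' : (N : ℝ) ≠ 0 := by positivity
  have hn' : (n : ℝ) ≠ 0 := by positivity
  have hc' : (c : ℝ) ≠ 0 := Int.cast_ne_zero.2 hc
  have hk' : ∑ i, (k i : ℝ) = n := by exact_mod_cast hk
  have hterm : ∀ i, logPrimitive (α i / N + n / N * c * (k i / n)) - logPrimitive (α i / N) =
      (N : ℝ)⁻¹ * (logPrimitive (α i + k i * c) - logPrimitive (α i)) -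
        (N : ℝ)⁻¹ * c * Real.log N * k i := fun i => by
    have harg : (α i / N + n / N * c * (k i / n) : ℝ) = (N : ℝ)⁻¹ * (α i + k i * c) := by
      field_simp
    rw [harg, div_eq_inv_mul, logPrimitive_mul (inv_ne_zero hN'),
      logPrimitive_mul (inv_ne_zero hN'), Real.log_inv]
    ring
  rw [rate, if_neg hc, Finset.sum_congr rfl fun i _ => hterm i, Finset.sum_sub_distrib,
    ← Finset.mul_sum, ← Finset.mul_sum, hk']
  field_simp

lemma logLik_zero {N n : ℕ} (hN : 0 < N) (hn : 0 < n) {k α : 𝒳 → ℕ} (hk : ∑ i, k i = n)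
    (hα : ∀ i, 0 < α i) :
    logLik 0 N n k α = rate (n / N) 0 (fun i => k i / n) (fun i => α i / N) := by
  have hk' : ∑ i, (k i : ℝ) = n := by exact_mod_cast hk
  have hlog : ∀ i, Real.log (α i / N) = Real.log (α i) - Real.log N := fun i =>
    Real.log_div (Nat.cast_ne_zero.2 (hα i).ne') (Nat.cast_ne_zero.2 hN.ne')
  have hn' : (n : ℝ) ≠ 0 := Nat.cast_ne_zero.2 hn.ne'
  calc logLik 0 N n k α
      = (∑ i, k i * Real.log (α i)) / n - (∑ i, (k i : ℝ)) / n * Real.log N := by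
        simp [logLik, hk', hn']
    _ = ∑ i, (k i / n : ℝ) * (Real.log (α i) - Real.log N) := by
        simp_rw [mul_sub, Finset.sum_sub_distrib, ← Finset.sum_mul, Finset.sum_div,
          div_mul_eq_mul_div]
    _ = rate (n / N) 0 (fun i => k i / n) (fun i => α i / N) := by simp [rate, hlog]

lemma abs_logLik_sub_rate_le {c : ℤ} {N n : ℕ} (hN : 0 < N) (hn : 0 < n) {k α : 𝒳 → ℕ}
    (hαN : ∑ i, α i = N) (hk : ∑ i, k i = n) (hα : ∀ i, 0 < α i)
    (hαk : ∀ i, (1 : ℝ) ≤ α i + k i * c) :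
    |logLik c N n k α - rate (n / N) c (fun i => k i / n) (fun i => α i / N)| ≤
      Fintype.card 𝒳 * (Real.log (N + n * |(c : ℝ)|) / n) := by
  rcases eq_or_ne c 0 with rfl | hc
  · have : 0 ≤ Real.log (N : ℝ) := Real.log_natCast_nonneg N
    rw [logLik_zero hN hn hk hα]
    simp only [sub_self, abs_zero, Int.cast_zero, mul_zero, add_zero]
    positivity
  set B : ℝ := N + n * |(c : ℝ)|
  have hc' : (c : ℝ) ≠ 0 := Int.cast_ne_zero.2 hc
  have : (0 : ℝ) < n := Nat.cast_pos.2 hn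
  have hterm : ∀ i, |logPrimitive (α i + k i * c) - logPrimitive (α i) -
      c * ∑ l ∈ Finset.range (k i), Real.log (α i + l * c)| ≤ |(c : ℝ)| * Real.log B := fun i => by
    have hαi : (α i : ℝ) ≤ N := by
      exact_mod_cast (Finset.single_le_sum_of_canonicallyOrdered (Finset.mem_univ i)).trans_eq hαN
    have hki : (k i : ℝ) ≤ n := by
      exact_mod_cast (Finset.single_le_sum_of_canonicallyOrdered (Finset.mem_univ i)).trans_eq hk
    have hkc : k i * (c : ℝ) ≤ n * |(c : ℝ)| :=
      (mul_le_mul_of_nonneg_left (le_abs_self _) (Nat.cast_nonneg _)).trans (by gcongr)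
    exact abs_logPrimitive_sub_sub_mul_sum_log_le (by exact_mod_cast hα i) (hαk i)
      (hαi.trans (le_add_of_nonneg_right (by positivity))) (add_le_add hαi hkc)
  have hdiff : logLik c N n k α - rate (n / N) c (fun i => k i / n) (fun i => α i / N) =
      -(n * c : ℝ)⁻¹ * ∑ i, (logPrimitive (α i + k i * c) - logPrimitive (α i) -
        c * ∑ l ∈ Finset.range (k i), Real.log (α i + l * c)) := by
    rw [rate_div hc hN hn hk, logLik, Finset.sum_sub_distrib _ fun i => (c : ℝ) * _,
      ← Finset.mul_sum]
    field_simp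
    ring_nf
  rw [hdiff, abs_mul, abs_neg, abs_inv, abs_mul, Nat.abs_cast]
  calc _ ≤ ((n : ℝ) * |(c : ℝ)|)⁻¹ * ∑ _i : 𝒳, |(c : ℝ)| * Real.log B := by
        gcongr
        exact (Finset.abs_sum_le_sum_abs _ _).trans (Finset.sum_le_sum fun i _ => hterm i)
    _ = Fintype.card 𝒳 * (Real.log B / n) := by
        have := abs_pos.2 hc'
        simp only [Finset.sum_const, Finset.card_univ, nsmul_eq_mul]
        field_simp

lemma continuousAt_rate_of_ne_zero {β : ℝ} (hβ : β ≠ 0) {c : ℤ} (hc : c ≠ 0) (p q : 𝒳 → ℝ) :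
    ContinuousAt (fun w : ℝ × (𝒳 → ℝ) × (𝒳 → ℝ) => rate w.1 c w.2.1 w.2.2) (β, p, q) := by
  have hG := continuous_logPrimitive
  simp only [rate, if_neg hc]
  have hsum : Continuous fun w : ℝ × (𝒳 → ℝ) × (𝒳 → ℝ) =>
      ∑ i, (logPrimitive (w.2.2 i + w.1 * c * w.2.1 i) - logPrimitive (w.2.2 i)) := by
    fun_prop
  exact ((continuousAt_fst.mul continuousAt_const).inv₀
    (mul_ne_zero hβ (Int.cast_ne_zero.2 hc))).mul hsum.continuousAt

lemma continuousAt_rate {β : ℝ} (hβ : β ≠ 0) (c : ℤ) (p : 𝒳 → ℝ) {q : 𝒳 → ℝ}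
    (hq : ∀ i, q i ≠ 0) :
    ContinuousAt (fun w : ℝ × (𝒳 → ℝ) × (𝒳 → ℝ) => rate w.1 c w.2.1 w.2.2) (β, p, q) := by
  rcases eq_or_ne c 0 with rfl | hc
  · simp only [rate, if_true]
    exact tendsto_finsetSum _ fun i _ => ContinuousAt.mul (by fun_prop)
      (ContinuousAt.log (by fun_prop) (hq i))
  · exact continuousAt_rate_of_ne_zero hβ hc p q

lemma rate_zero_nonpos (b : ℝ) {p : 𝒳 → ℝ} (hp : ∀ i, 0 ≤ p i) (q : stdSimplex ℝ 𝒳) :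
    rate b 0 p q ≤ 0 := by
  rw [rate, if_pos rfl]
  exact Finset.sum_nonpos fun i _ => mul_nonpos_of_nonneg_of_nonpos (hp i)
    (Real.log_nonpos (stdSimplex.zero_le q i) (stdSimplex.le_one q i))

lemma bddAbove_range_rate {β : ℝ} (hβ : β ≠ 0) (c : ℤ) {p : 𝒳 → ℝ} (hp : ∀ i, 0 ≤ p i) :
    BddAbove (Set.range fun q : stdSimplex ℝ 𝒳 => rate β c p q) := by
  rcases eq_or_ne c 0 with rfl | hc
  · refine ⟨0, ?_⟩
    rintro _ ⟨q, rfl⟩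
    exact rate_zero_nonpos β hp q
  · refine (isCompact_range ?_).bddAbove
    exact continuous_iff_continuousAt.2 fun q =>
      (continuousAt_rate_of_ne_zero hβ hc p q).comp (f := fun q : stdSimplex ℝ 𝒳 => (β, p, ⇑q))
        (continuousAt_const.prodMk (continuousAt_const.prodMk continuousAt_subtype_val))

lemma eventually_rate_le_of_ne_zero {β : ℝ} (hβ : β ≠ 0) {c : ℤ} (hc : c ≠ 0) (p : 𝒳 → ℝ)
    {ε : ℝ} (hε : 0 < ε) :
    ∀ᶠ w in 𝓝 (β, p), ∀ q : stdSimplex ℝ 𝒳, rate w.1 c w.2 q ≤ rate β c p q + ε := by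
  suffices h : ∀ᶠ w in 𝓝 (β, p), ∀ q ∈ (Set.univ : Set (stdSimplex ℝ 𝒳)),
      rate w.1 c w.2 q ≤ rate β c p q + ε by simpa using h
  refine isCompact_univ.eventually_forall_of_forall_eventually fun q _ => ?_
  have hcont := continuousAt_rate_of_ne_zero hβ hc p q
  have hcoe : ContinuousAt (fun z : (ℝ × (𝒳 → ℝ)) × stdSimplex ℝ 𝒳 => ⇑z.2) ((β, p), q) :=
    continuousAt_subtype_val.comp' continuousAt_snd
  have hmoving : ContinuousAt
      (fun z : (ℝ × (𝒳 → ℝ)) × stdSimplex ℝ 𝒳 => rate z.1.1 c z.1.2 z.2) ((β, p), q) :=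
    ContinuousAt.comp' (x := ((β, p), q)) hcont
      (continuousAt_fst.fst.prodMk (continuousAt_fst.snd.prodMk hcoe))
  have hfixed : ContinuousAt
      (fun z : (ℝ × (𝒳 → ℝ)) × stdSimplex ℝ 𝒳 => rate β c p z.2 + ε) ((β, p), q) :=
    (ContinuousAt.comp' (x := ((β, p), q)) hcont
      (continuousAt_const.prodMk (continuousAt_const.prodMk hcoe))).add_const ε
  exact (hmoving.eventually_lt hfixed (lt_add_of_pos_right _ hε)).mono fun z hz => hz.le

lemma eventually_rate_zero_le {β : ℝ} {p : 𝒳 → ℝ} (hp : ∀ i, 0 < p i) {δ : ℝ} (hδ : 0 < δ) :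
    ∀ᶠ w in 𝓝 (β, p), ∀ q : stdSimplex ℝ 𝒳, rate w.1 0 w.2 q ≤ (1 - δ) * rate β 0 p q := by
  have hnear : ∀ᶠ w : ℝ × (𝒳 → ℝ) in 𝓝 (β, p), ∀ i, (1 - δ) * p i < w.2 i := by
    refine eventually_all.2 fun i => Tendsto.eventually_const_lt (v := p i) ?_ ?_
    · exact mul_lt_of_lt_one_left (hp i) (sub_lt_self _ hδ)
    · exact Continuous.tendsto' (by fun_prop) _ _ rfl
  filter_upwards [hnear] with w hw q
  rw [rate, rate, if_pos rfl, if_pos rfl, Finset.mul_sum]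
  refine Finset.sum_le_sum fun i _ => ?_
  rw [← mul_assoc]
  exact mul_le_mul_of_nonpos_right (hw i).le
    (Real.log_nonpos (stdSimplex.zero_le q i) (stdSimplex.le_one q i))

/-- On the whole simplex `rate` is unbounded below for `c = 0`, so the uniformity in `q` is
one-sided. -/
lemma eventually_forall_rate_le {β : ℝ} (hβ : β ≠ 0) (c : ℤ) {p : 𝒳 → ℝ} (hp : ∀ i, 0 < p i)
    {A : Set (stdSimplex ℝ 𝒳)} {s b : ℝ} (hA : ∀ q ∈ A, rate β c p q ≤ s) (hsb : s < b) :
    ∀ᶠ w in 𝓝 (β, p), ∀ q ∈ A, rate w.1 c w.2 q ≤ b := by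
  rcases eq_or_ne c 0 with rfl | hc
  · obtain ⟨δ, hδb, hδ⟩ : ∃ δ, (1 - δ) * s < b ∧ δ ∈ Set.Ioo (0 : ℝ) 1 := by
      have hlim : Tendsto (fun δ : ℝ => (1 - δ) * s) (𝓝[>] 0) (𝓝 s) := by
        refine tendsto_nhdsWithin_of_tendsto_nhds (Continuous.tendsto' (by fun_prop) _ _ ?_)
        ring
      exact ((hlim.eventually_lt_const hsb).and (Ioo_mem_nhdsGT one_pos)).exists
    filter_upwards [eventually_rate_zero_le hp hδ.1] with w hw q hq
    calc rate w.1 0 w.2 q ≤ (1 - δ) * rate β 0 p q := hw q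
      _ ≤ (1 - δ) * s := mul_le_mul_of_nonneg_left (hA q hq) (sub_nonneg.2 hδ.2.le)
      _ ≤ b := hδb.le
  · filter_upwards [eventually_rate_le_of_ne_zero hβ hc p (sub_pos.2 hsb)] with w hw q hq
    linarith [hw q, hA q hq]

lemma polyaLSet_eq {β : ℝ} {c : ℤ} {A : Set (stdSimplex ℝ 𝒳)} {p : stdSimplex ℝ 𝒳}
    (h : ∀ q ∈ A, polyaL β c q p = -rate β c p q - 1) {s : ℝ}
    (hs : IsLUB ((fun q : stdSimplex ℝ 𝒳 => rate β c p q) '' A) s) :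
    polyaLSet β c A p = ((-s - 1 : ℝ) : EReal) := by
  refine le_antisymm (EReal.le_of_forall_lt_iff_le.1 fun z hz => ?_)
    (le_iInf₂ fun q hq => ?_)
  · rw [EReal.coe_lt_coe_iff] at hz
    obtain ⟨_, ⟨q, hq, rfl⟩, hqz⟩ := (lt_isLUB_iff hs).1 (show -z - 1 < s by linarith)
    refine iInf₂_le_of_le q hq ?_
    rw [h q hq, EReal.coe_le_coe_iff]
    linarith
  · rw [h q hq, EReal.coe_le_coe_iff]
    linarith [hs.1 ⟨q, hq, rfl⟩]

lemma polyaLSet_lt_top_iff {β : ℝ} {c : ℤ} {A : Set (stdSimplex ℝ 𝒳)}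
    {p : stdSimplex ℝ 𝒳} : polyaLSet β c A p < ⊤ ↔ A.Nonempty := by
  simp [polyaLSet, iInf_lt_iff, EReal.coe_lt_top, Set.Nonempty]

end Rate

/-! ### Laplace's principle for priors that are not exponentially small -/

lemma tendsto_log_of_exp_bounds {Z : ℕ → ℝ} {s : ℝ}
    (hlower : ∀ b < s, ∀ᶠ n : ℕ in atTop, Real.exp (n * b) ≤ Z n)
    (hupper : ∀ b, s < b → ∀ᶠ n : ℕ in atTop, Z n ≤ Real.exp (n * b)) :
    Tendsto (fun n : ℕ => 1 / (n : ℝ) * Real.log (Z n)) atTop (𝓝 s) := by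
  refine tendsto_order.2 ⟨fun a ha => ?_, fun a ha => ?_⟩
  · obtain ⟨b, hab, hbs⟩ := exists_between ha
    filter_upwards [hlower b hbs, eventually_gt_atTop 0] with n hn hn0
    have hlog := Real.log_le_log (Real.exp_pos _) hn
    rw [Real.log_exp] at hlog
    rw [one_div_mul_eq_div, lt_div_iff₀ (Nat.cast_pos.2 hn0), mul_comm]
    exact (mul_lt_mul_of_pos_left hab (Nat.cast_pos.2 hn0)).trans_le hlog
  · obtain ⟨b, hsb, hba⟩ := exists_between ha
    filter_upwards [hlower (s - 1) (sub_one_lt s), hupper b hsb, eventually_gt_atTop 0]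
      with n hpos hn hn0
    have hlog := Real.log_le_log ((Real.exp_pos _).trans_le hpos) hn
    rw [Real.log_exp] at hlog
    rw [one_div_mul_eq_div, div_lt_iff₀ (Nat.cast_pos.2 hn0), mul_comm]
    exact hlog.trans_lt (mul_lt_mul_of_pos_left hba (Nat.cast_pos.2 hn0))

section Laplace

variable {𝒳 : Type*} [Fintype 𝒳] [DecidableEq 𝒳]

/-- The integral of `exp (n f)` over the configurations of `N` balls with proportions in `A`,
with respect to the prior `π`. -/
noncomputable def laplaceSum (π : PMF (𝒳 → ℕ)) (N n : ℕ) (A : Set (stdSimplex ℝ 𝒳))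
    (f : (𝒳 → ℕ) → ℝ) : ℝ :=
  ∑ α ∈ configs A N, (π α).toReal * Real.exp (n * f α)

lemma laplaceSum_le {π : PMF (𝒳 → ℕ)} {N n : ℕ} {A : Set (stdSimplex ℝ 𝒳)}
    {f : (𝒳 → ℕ) → ℝ} {b : ℝ} (h : ∀ α ∈ configs A N, f α ≤ b) :
    laplaceSum π N n A f ≤ Real.exp (n * b) := by
  calc laplaceSum π N n A f ≤ priorMass π N A * Real.exp (n * b) := by
        rw [laplaceSum, priorMass, Finset.sum_mul]
        gcongr with α hα
        exact h α hα
    _ ≤ Real.exp (n * b) := mul_le_of_le_one_left (Real.exp_pos _).le (priorMass_le_one π N A)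

lemma le_laplaceSum {π : PMF (𝒳 → ℕ)} {N n : ℕ} {A G : Set (stdSimplex ℝ 𝒳)} (hGA : G ⊆ A)
    {f : (𝒳 → ℕ) → ℝ} {b : ℝ} (h : ∀ α ∈ configs G N, b ≤ f α) :
    priorMass π N G * Real.exp (n * b) ≤ laplaceSum π N n A f := by
  calc priorMass π N G * Real.exp (n * b)
      ≤ ∑ α ∈ configs G N, (π α).toReal * Real.exp (n * f α) := by
        rw [priorMass, Finset.sum_mul]
        gcongr with α hα
        exact h α hα
    _ ≤ laplaceSum π N n A f :=
        Finset.sum_le_sum_of_subset_of_nonneg (configs_mono hGA N) fun _ _ _ => by positivity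

variable {π : ℕ → PMF (𝒳 → ℕ)} {N : ℕ → ℕ} {A : Set (stdSimplex ℝ 𝒳)} {F : stdSimplex ℝ 𝒳 → ℝ}
  {s : ℝ} {f : ℕ → (𝒳 → ℕ) → ℝ}

lemma eventually_exp_le_laplaceSum (hAo : IsOpen A) (hπ : NotExpSmall π N A)
    (hs : IsLUB (F '' A) s)
    (hf : ∀ q ∈ A, ∀ b < F q, ∃ G, IsOpen G ∧ q ∈ G ∧
      ∀ᶠ n in atTop, ∀ α ∈ configs (A ∩ G) (N n), b ≤ f n α) {b : ℝ} (hb : b < s) :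
    ∀ᶠ n : ℕ in atTop, Real.exp (n * b) ≤ laplaceSum (π n) (N n) n A (f n) := by
  obtain ⟨b', hbb', hb's⟩ := exists_between hb
  obtain ⟨_, ⟨q, hq, rfl⟩, hb'q⟩ := (lt_isLUB_iff hs).1 hb's
  obtain ⟨G, hGo, hqG, hG⟩ := hf q hq b' hb'q
  filter_upwards [hG, hπ _ Set.inter_subset_left (hAo.inter hGo) ⟨q, hq, hqG⟩ _ (sub_pos.2 hbb')]
    with n hn hmass
  calc Real.exp (n * b) = Real.exp (-((b' - b) * n)) * Real.exp (n * b') := by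
        rw [← Real.exp_add]
        ring_nf
    _ ≤ priorMass (π n) (N n) (A ∩ G) * Real.exp (n * b') := by gcongr
    _ ≤ laplaceSum (π n) (N n) n A (f n) := le_laplaceSum Set.inter_subset_left hn

lemma tendsto_log_laplaceSum (hAo : IsOpen A) (hπ : NotExpSmall π N A) (hs : IsLUB (F '' A) s)
    (hupper : ∀ b, s < b → ∀ᶠ n in atTop, ∀ α ∈ configs A (N n), f n α ≤ b)
    (hlower : ∀ q ∈ A, ∀ b < F q, ∃ G, IsOpen G ∧ q ∈ G ∧
      ∀ᶠ n in atTop, ∀ α ∈ configs (A ∩ G) (N n), b ≤ f n α) :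
    Tendsto (fun n : ℕ => 1 / (n : ℝ) * Real.log (laplaceSum (π n) (N n) n A (f n))) atTop
      (𝓝 s) :=
  tendsto_log_of_exp_bounds (fun _ hb => eventually_exp_le_laplaceSum hAo hπ hs hlower hb)
    fun b hb => (hupper b hb).mono fun _ hn => laplaceSum_le hn

end Laplace

/-! ### Concentration of the sample frequencies -/

lemma sum_mul_exp_le_exp_sq {ι : Type*} [Fintype ι] {p f : ι → ℝ} (hp : ∀ j, 0 ≤ p j)
    (hp1 : ∑ j, p j = 1) (hf : ∀ j, |f j| ≤ 1) (hpf : ∑ j, p j * f j = 0) {s : ℝ}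
    (hs : |s| ≤ 1) : ∑ j, p j * Real.exp (s * f j) ≤ Real.exp (s ^ 2) := by
  have hquad : ∀ j, Real.exp (s * f j) ≤ 1 + s * f j + s ^ 2 := fun j => by
    have hsf : |s * f j| ≤ 1 := by
      rw [abs_mul]
      exact mul_le_one₀ hs (abs_nonneg _) (hf j)
    have hsq : (s * f j) ^ 2 ≤ s ^ 2 := by
      rw [mul_pow]
      exact mul_le_of_le_one_right (sq_nonneg _) ((sq_le_one_iff_abs_le_one _).2 (hf j))
    linarith [(abs_le.1 (Real.abs_exp_sub_one_sub_id_le hsf)).2]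
  calc ∑ j, p j * Real.exp (s * f j) ≤ ∑ j, p j * (1 + s * f j + s ^ 2) :=
        Finset.sum_le_sum fun j _ => mul_le_mul_of_nonneg_left (hquad j) (hp j)
    _ = ∑ j, p j + s * ∑ j, p j * f j + (∑ j, p j) * s ^ 2 := by
        rw [Finset.mul_sum, Finset.sum_mul, ← Finset.sum_add_distrib, ← Finset.sum_add_distrib]
        exact Finset.sum_congr rfl fun j _ => by ring
    _ = s ^ 2 + 1 := by
        rw [hp1, hpf]
        ring
    _ ≤ Real.exp (s ^ 2) := Real.add_one_le_exp _

lemma sum_snoc {𝒳 : Type*} [Fintype 𝒳] {m : ℕ} (g : (Fin (m + 1) → 𝒳) → ℝ) :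
    ∑ x, g x = ∑ x : Fin m → 𝒳, ∑ j, g (Fin.snoc x j) := by
  rw [← (Fin.snocEquiv fun _ : Fin (m + 1) => 𝒳).sum_comp, Fintype.sum_prod_type_right]
  rfl

lemma count_snoc {𝒳 : Type*} [DecidableEq 𝒳] {m : ℕ} (x : Fin m → 𝒳) (j i : 𝒳) :
    count (Fin.snoc x j : Fin (m + 1) → 𝒳) i = count x i + if j = i then 1 else 0 := by
  simp only [count, Finset.card_filter, Fin.sum_univ_castSucc, Fin.snoc_castSucc, Fin.snoc_last]

section Concentration

variable {𝒳 : Type*} [Fintype 𝒳] [DecidableEq 𝒳]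

/-- The conditional probability that the next ball has colour `j`, given that `x` has been drawn
from the urn `α`. -/
noncomputable def drawProb (c : ℤ) (α : 𝒳 → ℕ) {m : ℕ} (x : Fin m → 𝒳) (j : 𝒳) : ℝ :=
  (α j + count x j * c) / ((∑ i, (α i : ℝ)) + m * c)

lemma sampleProb_snoc (c : ℤ) (α : 𝒳 → ℕ) {m : ℕ} (x : Fin m → 𝒳) (j : 𝒳) :
    sampleProb c α (Fin.snoc x j : Fin (m + 1) → 𝒳) = sampleProb c α x * drawProb c α x j := by
  have hcolour : ∀ i, ∏ l ∈ Finset.range (count (Fin.snoc x j : Fin (m + 1) → 𝒳) i),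
      ((α i : ℝ) + l * c) = (∏ l ∈ Finset.range (count x i), ((α i : ℝ) + l * c)) *
        if i = j then (α j : ℝ) + count x j * c else 1 := fun i => by
    rw [count_snoc]
    rcases eq_or_ne i j with rfl | hij
    · simp [Finset.prod_range_succ]
    · simp [hij, hij.symm]
  simp_rw [sampleProb, drawProb, hcolour, Finset.prod_mul_distrib, Finset.prod_range_succ,
    Finset.prod_ite_eq', Finset.mem_univ, if_true, div_mul_div_comm]

lemma sum_drawProb {c : ℤ} {α : 𝒳 → ℕ} {m : ℕ} (h : (∑ i, (α i : ℝ)) + m * c ≠ 0)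
    (x : Fin m → 𝒳) : ∑ j, drawProb c α x j = 1 := by
  have hcount : ∑ j, (count x j : ℝ) = m := by exact_mod_cast sum_count x
  simp_rw [drawProb, ← Finset.sum_div, Finset.sum_add_distrib, ← Finset.sum_mul, hcount]
  exact div_self h

lemma drawProb_nonneg {c : ℤ} {α : 𝒳 → ℕ} {m : ℕ} (h : Meaningful c m α) (x : Fin m → 𝒳)
    (j : 𝒳) : 0 ≤ drawProb c α x j :=
  div_nonneg ((h.mono (count_le x j)).nonneg j) ((h.nonneg j).trans (by
    gcongr
    exact le_sum_cast α j))

/-- The proportion of colour `i` in the urn is a martingale; this is its change after the sample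
`x`, divided by `c`, which also makes sense for `c = 0`. -/
noncomputable def urnMartingale (c : ℤ) (α : 𝒳 → ℕ) (i : 𝒳) {m : ℕ} (x : Fin m → 𝒳) : ℝ :=
  (count x i - m * (α i / ∑ j, (α j : ℝ))) / ((∑ j, (α j : ℝ)) + m * c)

lemma urnMartingale_snoc {c : ℤ} {α : 𝒳 → ℕ} {m : ℕ} (h₀ : ∑ j, (α j : ℝ) ≠ 0)
    (h : (∑ j, (α j : ℝ)) + m * c ≠ 0) (h' : (∑ j, (α j : ℝ)) + (m + 1 : ℕ) * c ≠ 0)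
    (i : 𝒳) (x : Fin m → 𝒳) (j : 𝒳) :
    urnMartingale c α i (Fin.snoc x j : Fin (m + 1) → 𝒳) = urnMartingale c α i x +
      ((if j = i then 1 else 0) - drawProb c α x i) / ((∑ j, (α j : ℝ)) + (m + 1 : ℕ) * c) := by
  rw [urnMartingale, urnMartingale, drawProb, count_snoc]
  push_cast at h' ⊢
  field_simp
  ring

lemma sum_drawProb_mul_exp_le {c : ℤ} {α : 𝒳 → ℕ} {m : ℕ} (hm : Meaningful c m α)
    (h : (∑ i, (α i : ℝ)) + m * c ≠ 0) (x : Fin m → 𝒳) (i : 𝒳) {s : ℝ} (hs : |s| ≤ 1) :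
    ∑ j, drawProb c α x j * Real.exp (s * ((if j = i then 1 else 0) - drawProb c α x i)) ≤
      Real.exp (s ^ 2) := by
  have hsum := sum_drawProb h x
  have hnonneg := drawProb_nonneg hm x
  have hle : drawProb c α x i ≤ 1 :=
    hsum ▸ Finset.single_le_sum (fun j _ => hnonneg j) (Finset.mem_univ i)
  refine sum_mul_exp_le_exp_sq hnonneg hsum (fun j => ?_) ?_ hs
  · have := hnonneg i
    rw [abs_le]
    split_ifs <;> constructor <;> linarith
  · simp [mul_sub, ← Finset.sum_mul, hsum]

lemma sum_sampleProb_snoc_mul_exp_le {c : ℤ} {α : 𝒳 → ℕ} {D t : ℝ} (hD : 0 < D)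
    (ht : |t| ≤ D) (i : 𝒳) {m : ℕ} (hm : Meaningful c m α) (h₀ : 0 < ∑ j, (α j : ℝ))
    (h₁ : 0 < (∑ j, (α j : ℝ)) + m * c) (h₂ : D ≤ (∑ j, (α j : ℝ)) + (m + 1 : ℕ) * c)
    (x : Fin m → 𝒳) :
    ∑ j, sampleProb c α (Fin.snoc x j : Fin (m + 1) → 𝒳) *
        Real.exp (t * urnMartingale c α i (Fin.snoc x j : Fin (m + 1) → 𝒳)) ≤
      sampleProb c α x * Real.exp (t * urnMartingale c α i x) * Real.exp ((t / D) ^ 2) := by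
  set S : ℝ := (∑ j, (α j : ℝ)) + (m + 1 : ℕ) * c
  have hS : 0 < S := hD.trans_le h₂
  have htS : |t / S| ≤ |t / D| := by
    rw [abs_div, abs_div, abs_of_pos hD, abs_of_pos hS]
    gcongr
  have hdraw := sum_drawProb_mul_exp_le hm h₁.ne' x i (s := t / S) (by
    rw [abs_div, abs_of_pos hS]
    exact div_le_one_of_le₀ (ht.trans h₂) hS.le)
  calc _ = sampleProb c α x * Real.exp (t * urnMartingale c α i x) *
        ∑ j, drawProb c α x j *
          Real.exp (t / S * ((if j = i then 1 else 0) - drawProb c α x i)) := by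
        rw [Finset.mul_sum]
        refine Finset.sum_congr rfl fun j _ => ?_
        rw [sampleProb_snoc, urnMartingale_snoc h₀.ne' h₁.ne' hS.ne', mul_add, Real.exp_add,
          mul_div_assoc', div_mul_eq_mul_div]
        ring
    _ ≤ _ := by
        have := sampleProb_nonneg hm x
        gcongr
        exact hdraw.trans (Real.exp_le_exp.2 (sq_le_sq.2 htS))

lemma sum_sampleProb_mul_exp_urnMartingale_le {c : ℤ} {α : 𝒳 → ℕ} {D t : ℝ} (hD : 0 < D)
    (ht : |t| ≤ D) (i : 𝒳) {n : ℕ} (hn : Meaningful c n α)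
    (hDα : ∀ l ≤ n, D ≤ (∑ j, (α j : ℝ)) + (l : ℕ) * c) :
    ∑ x : Fin n → 𝒳, sampleProb c α x * Real.exp (t * urnMartingale c α i x) ≤
      Real.exp (n * (t / D) ^ 2) := by
  induction n with
  | zero => simp [sampleProb, urnMartingale, count]
  | succ m ih =>
    have hm : Meaningful c m α := hn.mono m.le_succ
    have ih := ih hm fun l hl => hDα l (hl.trans m.le_succ)
    have h₀ : 0 < ∑ j, (α j : ℝ) := by simpa using hD.trans_le (hDα 0 (Nat.zero_le _))
    have h₁ := hD.trans_le (hDα m m.le_succ)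
    rw [sum_snoc]
    calc _ ≤ ∑ x : Fin m → 𝒳, sampleProb c α x * Real.exp (t * urnMartingale c α i x) *
          Real.exp ((t / D) ^ 2) := Finset.sum_le_sum fun x _ =>
            sum_sampleProb_snoc_mul_exp_le hD ht i hm h₀ h₁ (hDα (m + 1) le_rfl) x
      _ ≤ Real.exp (m * (t / D) ^ 2) * Real.exp ((t / D) ^ 2) := by
          rw [← Finset.sum_mul]
          gcongr
      _ = Real.exp ((m + 1 : ℕ) * (t / D) ^ 2) := by
          rw [← Real.exp_add]
          push_cast
          ring_nf

lemma sum_sampleProb_le_abs_urnMartingale_le {c : ℤ} {α : 𝒳 → ℕ} {D t δ : ℝ} (ht₀ : 0 ≤ t)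
    (hD : 0 < D) (ht : t ≤ D) (i : 𝒳) {n : ℕ} (hn : Meaningful c n α)
    (hDα : ∀ l ≤ n, D ≤ (∑ j, (α j : ℝ)) + (l : ℕ) * c) :
    ∑ x : Fin n → 𝒳 with δ ≤ |urnMartingale c α i x|, sampleProb c α x ≤
      2 * Real.exp (n * (t / D) ^ 2 - t * δ) := by
  have hmgf := sum_sampleProb_mul_exp_urnMartingale_le hD ((abs_of_nonneg ht₀).trans_le ht) i hn hDα
  have hmgf' := sum_sampleProb_mul_exp_urnMartingale_le (t := -t) hD
    ((abs_neg t).trans_le ((abs_of_nonneg ht₀).trans_le ht)) i hn hDα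
  rw [neg_div, neg_sq] at hmgf'
  have hmarkov : ∀ x : Fin n → 𝒳, δ ≤ |urnMartingale c α i x| →
      Real.exp (t * δ) ≤ Real.exp (t * urnMartingale c α i x) +
        Real.exp (-t * urnMartingale c α i x) := fun x hx => by
    calc Real.exp (t * δ) ≤ Real.exp |t * urnMartingale c α i x| := by
          rw [abs_mul, abs_of_nonneg ht₀]
          gcongr
      _ ≤ _ := by
          rw [neg_mul]
          exact Real.exp_abs_le _
  have hprob := sampleProb_nonneg hn
  calc _ = (∑ x : Fin n → 𝒳 with δ ≤ |urnMartingale c α i x|,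
        sampleProb c α x * Real.exp (t * δ)) * Real.exp (-(t * δ)) := by
        rw [← Finset.sum_mul, mul_assoc, ← Real.exp_add, add_neg_cancel, Real.exp_zero, mul_one]
    _ ≤ (∑ x : Fin n → 𝒳, sampleProb c α x * (Real.exp (t * urnMartingale c α i x) +
        Real.exp (-t * urnMartingale c α i x))) * Real.exp (-(t * δ)) := by
        gcongr ?_ * _
        refine (Finset.sum_le_sum fun x hx => ?_).trans (Finset.sum_le_sum_of_subset_of_nonneg
          (Finset.filter_subset _ _) fun x _ _ => mul_nonneg (hprob x) (by positivity))
        exact mul_le_mul_of_nonneg_left (hmarkov x (Finset.mem_filter.1 hx).2) (hprob x)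
    _ ≤ (Real.exp (n * (t / D) ^ 2) + Real.exp (n * (t / D) ^ 2)) * Real.exp (-(t * δ)) := by
        simp_rw [mul_add, Finset.sum_add_distrib]
        gcongr
    _ = 2 * Real.exp (n * (t / D) ^ 2 - t * δ) := by
        rw [← two_mul, mul_assoc, ← Real.exp_add, sub_eq_add_neg]

lemma sum_sampleProb_deviation_le [Nontrivial 𝒳] {c : ℤ} {α : 𝒳 → ℕ} {n : ℕ} (hn : 0 < n)
    (h : Meaningful c n α) (hα : 0 < ∑ j, (α j : ℝ)) {K ε τ : ℝ}
    (hK : (∑ j, (α j : ℝ)) + n * |(c : ℝ)| ≤ K * ∑ j, (α j : ℝ)) (hτ₀ : 0 ≤ τ) (hτ : τ ≤ 1 / 2)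
    (hτε : 8 * τ * K ≤ ε) (i : 𝒳) :
    ∑ x : Fin n → 𝒳 with ε ≤ |(count x i : ℝ) / n - α i / ∑ j, (α j : ℝ)|, sampleProb c α x ≤
      2 * Real.exp (-(4 * τ ^ 2) * n) := by
  set S : ℝ := ∑ j, (α j : ℝ)
  have hn' : (0 : ℝ) < n := Nat.cast_pos.2 hn
  have hfinal : S / 2 ≤ S + n * c := h.half_sum_le
  have hS : 0 < S + n * c := (half_pos hα).trans_le hfinal
  have hSK : S + n * c ≤ K * S := (by gcongr; exact le_abs_self _ : _ ≤ _).trans hK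
  have hKS : 0 < K * S := hS.trans_le hSK
  have hK₀ : 0 < K := pos_of_mul_pos_left hKS hα.le
  have hhalf : ∀ l ≤ n, S / 2 ≤ S + (l : ℕ) * c := fun l hl => (h.mono hl).half_sum_le
  have hdev : ∀ x : Fin n → 𝒳, ε ≤ |(count x i : ℝ) / n - α i / S| →
      ε * n / (K * S) ≤ |urnMartingale c α i x| := fun x hx => by
    have hscale : urnMartingale c α i x = (count x i / n - α i / S) * n / (S + n * c) := by
      rw [urnMartingale, sub_mul, div_mul_cancel₀ _ hn'.ne', mul_comm (α i / S)]
    rw [hscale, abs_div, abs_mul, abs_of_pos hn', abs_of_pos hS]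
    gcongr
  calc _ ≤ ∑ x : Fin n → 𝒳 with ε * n / (K * S) ≤ |urnMartingale c α i x|, sampleProb c α x :=
        Finset.sum_le_sum_of_subset_of_nonneg
          (Finset.monotone_filter_right _ fun x _ => hdev x) fun x _ _ => sampleProb_nonneg h x
    _ ≤ 2 * Real.exp (n * (τ * S / (S / 2)) ^ 2 - τ * S * (ε * n / (K * S))) :=
        sum_sampleProb_le_abs_urnMartingale_le (by positivity) (half_pos hα) (by nlinarith) i h
          hhalf
    _ ≤ 2 * Real.exp (-(4 * τ ^ 2) * n) := by
        gcongr
        have hquot : τ * S / (S / 2) = 2 * τ := by field_simp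
        have hlin : τ * S * (ε * n / (K * S)) = τ * n * (ε / K) := by field_simp
        have hεK : 8 * τ ≤ ε / K := (le_div_iff₀ hK₀).2 hτε
        rw [hquot, hlin]
        nlinarith [mul_le_mul_of_nonneg_left hεK (by positivity : 0 ≤ τ * n)]

end Concentration

/-! ### The law of large numbers -/

section LawOfLargeNumbers

variable {Ω : Type*} [MeasurableSpace Ω] {μ : Measure Ω} [IsFiniteMeasure μ]

lemma ae_tendsto_zero_of_summable_measureReal {Y : ℕ → Ω → ℝ}
    (h : ∀ ε > 0, Summable fun n => μ.real {ω | ε ≤ |Y n ω|}) :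
    ∀ᵐ ω ∂μ, Tendsto (fun n => Y n ω) atTop (𝓝 0) := by
  have hsmall : ∀ k : ℕ, ∀ᵐ ω ∂μ, ∀ᶠ n in atTop, |Y n ω| < 1 / ((k : ℝ) + 1) := fun k => by
    have hsum : ∑' n, μ {ω | 1 / ((k : ℝ) + 1) ≤ |Y n ω|} ≠ ⊤ := by
      simpa only [ofReal_measureReal (measure_ne_top _ _)] using
        (h (1 / ((k : ℝ) + 1)) (by positivity)).tsum_ofReal_ne_top
    filter_upwards [ae_eventually_notMem hsum] with ω hω
    exact hω.mono fun n hn => not_le.1 hn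
  filter_upwards [ae_all_iff.2 hsmall] with ω hω
  refine Metric.tendsto_nhds.2 fun ε hε => ?_
  obtain ⟨k, hk⟩ := exists_nat_one_div_lt hε
  filter_upwards [hω k] with n hn
  rw [Real.dist_0_eq_abs]
  exact hn.trans hk

lemma measureReal_preimage_le_sum {α : Type*} [Fintype α] (X : Ω → α) (p : α → Prop)
    [DecidablePred p] :
    μ.real {ω | p (X ω)} ≤ ∑ x with p x, μ.real (X ⁻¹' {x}) := by
  refine (measureReal_mono ?_ (measure_ne_top _ _)).trans (measureReal_biUnion_finset_le _ _)
  intro ω hω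
  simpa using hω

variable {𝒳 : Type*} [Fintype 𝒳] [DecidableEq 𝒳] [Nontrivial 𝒳]

lemma summable_measureReal_deviation {c : ℤ} {β : ℝ} (hβ : 0 < β) {N : ℕ → ℕ}
    (hN : Tendsto (fun n : ℕ => (n : ℝ) / (N n : ℝ)) atTop (𝓝 β)) {α : ℕ → 𝒳 → ℕ}
    (hα : ∀ n, ∑ i, α n i = N n) (hm : ∀ᶠ n in atTop, Meaningful c n (α n))
    {X : (n : ℕ) → Ω → Fin n → 𝒳}
    (hX : ∀ᶠ n in atTop, ∀ x : Fin n → 𝒳, μ.real (X n ⁻¹' {x}) = sampleProb c (α n) x)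
    (i : 𝒳) {ε : ℝ} (hε : 0 < ε) :
    Summable fun n => μ.real {ω | ε ≤ |(count (X n ω) i : ℝ) / n - α n i / N n|} := by
  have hαN : ∀ n, ∑ j, (α n j : ℝ) = N n := fun n => by exact_mod_cast hα n
  set K : ℝ := 1 + (β + 1) * |(c : ℝ)|
  have : 0 < K := by positivity
  obtain ⟨τ, hτ₀, hτ, hτε⟩ : ∃ τ : ℝ, 0 < τ ∧ τ ≤ 1 / 2 ∧ 8 * τ * K ≤ ε := by
    refine ⟨min (1 / 2) (ε / (8 * K)), by positivity, min_le_left _ _, ?_⟩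
    have := (le_div_iff₀ (by positivity)).1 (min_le_right (1 / 2) (ε / (8 * K)))
    linarith
  have hgeom : Summable fun n : ℕ => 2 * Real.exp (-(4 * τ ^ 2) * n) := by
    simp_rw [mul_comm (-(4 * τ ^ 2))]
    exact (Real.summable_exp_nat_mul_iff.2 (neg_neg_of_pos (by positivity))).mul_left 2
  refine Summable.of_norm_bounded_eventually_nat hgeom ?_
  filter_upwards [hm, hX, eventually_pos_of_tendsto_div hβ hN, eventually_gt_atTop 0,
    hN.eventually_lt_const (lt_add_one β)] with n hmn hXn hNn hn hnβ
  have hNn' : (0 : ℝ) < N n := Nat.cast_pos.2 hNn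
  rw [Real.norm_of_nonneg measureReal_nonneg]
  have hbound := sum_sampleProb_deviation_le hn hmn (by rwa [hαN]) (K := K) (by
    rw [hαN]
    have := mul_le_mul_of_nonneg_right ((div_lt_iff₀ hNn').1 hnβ).le (abs_nonneg (c : ℝ))
    simp only [K]
    linarith) hτ₀.le hτ hτε i
  simp_rw [hαN, ← hXn] at hbound
  exact (measureReal_preimage_le_sum (X n) _).trans hbound

lemma ae_tendsto_count_div {c : ℤ} {β : ℝ} (hβ : 0 < β) {N : ℕ → ℕ}
    (hN : Tendsto (fun n : ℕ => (n : ℝ) / (N n : ℝ)) atTop (𝓝 β)) {α : ℕ → 𝒳 → ℕ}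
    (hα : ∀ n, ∑ i, α n i = N n) (hm : ∀ᶠ n in atTop, Meaningful c n (α n)) {p : 𝒳 → ℝ}
    (hp : ∀ i, Tendsto (fun n => (α n i : ℝ) / N n) atTop (𝓝 (p i)))
    {X : (n : ℕ) → Ω → Fin n → 𝒳}
    (hX : ∀ᶠ n in atTop, ∀ x : Fin n → 𝒳, μ.real (X n ⁻¹' {x}) = sampleProb c (α n) x) :
    ∀ᵐ ω ∂μ, ∀ i, Tendsto (fun n => (count (X n ω) i : ℝ) / n) atTop (𝓝 (p i)) := by
  refine ae_all_iff.2 fun i => ?_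
  filter_upwards [ae_tendsto_zero_of_summable_measureReal fun ε hε =>
    summable_measureReal_deviation hβ hN hα hm hX i hε] with ω hω
  simpa using hω.add (hp i)

end LawOfLargeNumbers

lemma tendsto_of_tendsto_sum_abs_sub {ι : Type*} [Fintype ι] {p : ℕ → ι → ℝ} {p₀ : ι → ℝ}
    (h : Tendsto (fun n => (1 / 2 : ℝ) * ∑ i, |p n i - p₀ i|) atTop (𝓝 0)) (i : ι) :
    Tendsto (fun n => p n i) atTop (𝓝 (p₀ i)) := by
  refine tendsto_iff_dist_tendsto_zero.2 (squeeze_zero (fun _ => dist_nonneg) (fun n => ?_)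
    (by simpa only [mul_zero] using h.const_mul 2))
  rw [Real.dist_eq, one_div, mul_inv_cancel_left₀ two_ne_zero]
  exact Finset.single_le_sum (f := fun j => |p n j - p₀ j|) (fun _ _ => abs_nonneg _)
    (Finset.mem_univ i)

/-! ### The posterior -/

section Posterior

variable {𝒳 : Type*} [Fintype 𝒳] [DecidableEq 𝒳]

lemma posterior_self {c : ℤ} {π : PMF (𝒳 → ℕ)} {N n : ℕ} {Φ : Set (stdSimplex ℝ 𝒳)}
    (hΦ : Φ ⊆ fullSupport 𝒳) (hm : ∀ α ∈ configs Φ N, Meaningful c n α)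
    (hπ : 0 < priorMass π N Φ) (x : Fin n → 𝒳) : posterior c π N Φ Φ x = 1 := by
  have hlik : ∀ α ∈ configs Φ N, 0 < sampleProb c α x := fun α hα =>
    sampleProb_pos (hm α hα) (pos_of_mem_configs hΦ hα) x
  obtain ⟨α, hα, hπα⟩ := Finset.exists_ne_zero_of_sum_ne_zero hπ.ne'
  refine div_self (ne_of_gt (Finset.sum_pos' (fun α hα => ?_) ⟨α, hα, ?_⟩))
  · exact mul_nonneg ENNReal.toReal_nonneg (hlik α hα).le
  · exact mul_pos (ENNReal.toReal_nonneg.lt_of_ne' hπα) (hlik α hα)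

lemma sampleProb_eq_exp_logLik_mul {c : ℤ} {N n : ℕ} (hn : n ≠ 0) {α : 𝒳 → ℕ}
    (h : Meaningful c n α) (hα : ∀ i, 0 < α i) (hN : ∑ i, α i = N) (x : Fin n → 𝒳) :
    sampleProb c α x = Real.exp (n * logLik c N n (count x) α) *
      (Real.exp (n * Real.log N) / ∏ l ∈ Finset.range n, ((N : ℝ) + l * c)) := by
  have hsum : ∑ i, (α i : ℝ) = N := by exact_mod_cast hN
  have hexp : n * logLik c N n (count x) α + n * Real.log N =
      ∑ i, ∑ l ∈ Finset.range (count x i), Real.log (α i + l * c) := by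
    rw [logLik, mul_sub, mul_div_cancel₀ _ (Nat.cast_ne_zero.2 hn), sub_add_cancel]
  rw [sampleProb, hsum, mul_div_assoc', ← Real.exp_add, hexp]
  simp_rw [Real.exp_sum]
  congr! 3 with i _ l hl
  exact (Real.exp_log (one_pos.trans_le
    (h.one_le (hα i) ((Finset.mem_range.1 hl).trans_le (count_le x i))))).symm

lemma posterior_eq_laplaceSum_div {c : ℤ} {π : PMF (𝒳 → ℕ)} {N n : ℕ}
    {Φ Q : Set (stdSimplex ℝ 𝒳)} (hn : n ≠ 0) (hΦ : Φ ⊆ fullSupport 𝒳) (hQΦ : Q ⊆ Φ)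
    (hm : ∀ α ∈ configs Φ N, Meaningful c n α) (hne : (configs Φ N).Nonempty) (x : Fin n → 𝒳) :
    posterior c π N Φ Q x =
      laplaceSum π N n Q (logLik c N n (count x)) /
        laplaceSum π N n Φ (logLik c N n (count x)) := by
  set κ := Real.exp (n * Real.log N) / ∏ l ∈ Finset.range n, ((N : ℝ) + l * c)
  have hlik : ∀ α ∈ configs Φ N,
      sampleProb c α x = Real.exp (n * logLik c N n (count x) α) * κ := fun α hα =>
    sampleProb_eq_exp_logLik_mul hn (hm α hα) (pos_of_mem_configs hΦ hα) (mem_configs.1 hα).1 x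
  have hκ : κ ≠ 0 := by
    obtain ⟨α, hα⟩ := hne
    have hpos := sampleProb_pos (hm α hα) (pos_of_mem_configs hΦ hα) x
    rw [hlik α hα] at hpos
    exact right_ne_zero_of_mul hpos.ne'
  have hsum : ∀ A ⊆ Φ, ∑ α ∈ configs A N, (π α).toReal * sampleProb c α x =
      laplaceSum π N n A (logLik c N n (count x)) * κ := fun A hA => by
    rw [laplaceSum, Finset.sum_mul]
    exact Finset.sum_congr rfl fun α hα => by rw [hlik α (configs_mono hA N hα), mul_assoc]
  rw [posterior, hsum Q hQΦ, hsum Φ subset_rfl, mul_div_mul_right _ _ hκ]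

variable {c : ℤ} {β : ℝ} {N : ℕ → ℕ} {A : Set (stdSimplex ℝ 𝒳)} {π : ℕ → PMF (𝒳 → ℕ)}

lemma neg_mul_le_of_meaningful
    (hN : Tendsto (fun n : ℕ => (n : ℝ) / (N n : ℝ)) atTop (𝓝 β)) (hAo : IsOpen A)
    (hm : ∀ᶠ n in atTop, ∀ α ∈ configs A (N n), Meaningful c n α) (hπ : NotExpSmall π N A)
    {q : stdSimplex ℝ 𝒳} (hq : q ∈ A) (i : 𝒳) : -(β * c) ≤ q i := by
  by_contra! hlt
  obtain ⟨b, hqb, hb⟩ := exists_between hlt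
  set G : Set (stdSimplex ℝ 𝒳) := A ∩ {q' | q' i < b}
  have hGo : IsOpen G := hAo.inter
    (isOpen_lt ((continuous_apply i).comp continuous_subtype_val) continuous_const)
  have hGA : G ⊆ A := Set.inter_subset_left
  obtain ⟨n, hmass, hmn, hbn⟩ :=
    (((hπ.mono hGA).eventually_priorMass_pos hGo ⟨q, hq, hqb⟩).and
      (hm.and ((hN.mul_const (c : ℝ)).neg.eventually_const_lt hb))).exists
  obtain ⟨α, hα⟩ := configs_nonempty_of_priorMass_pos hmass
  obtain ⟨-, q', hq', hqα⟩ := mem_configs.1 hα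
  have hlow : 0 ≤ ((α i : ℝ) + n * c) / N n :=
    div_nonneg ((hmn α (configs_mono hGA _ hα)).nonneg i) (Nat.cast_nonneg _)
  have hup : (α i : ℝ) / N n < b := hqα i ▸ hq'.2
  rw [add_div, mul_div_right_comm] at hlow
  linarith

lemma add_mul_pos_of_meaningful (hβ : 0 < β)
    (hN : Tendsto (fun n : ℕ => (n : ℝ) / (N n : ℝ)) atTop (𝓝 β)) (hAo : IsOpen A)
    (hA : A ⊆ fullSupport 𝒳) (hm : ∀ᶠ n in atTop, ∀ α ∈ configs A (N n), Meaningful c n α)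
    (hπ : NotExpSmall π N A) {p : 𝒳 → ℝ} {i : 𝒳} (hp : p i ∈ Set.Ioo 0 1)
    {q : stdSimplex ℝ 𝒳} (hq : q ∈ A) : 0 < q i + β * c * p i := by
  have hqi : 0 < q i := hA hq i
  rcases le_or_gt 0 c with hc | hc
  · have : (0 : ℝ) ≤ c := Int.cast_nonneg hc
    have := hp.1
    positivity
  · have hc' : (c : ℝ) < 0 := Int.cast_lt_zero.2 hc
    have := neg_mul_le_of_meaningful hN hAo hm hπ hq i
    nlinarith [mul_pos (mul_pos hβ (neg_pos.2 hc')) (sub_pos.2 hp.2)]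

variable {p : 𝒳 → ℝ} {x : (n : ℕ) → Fin n → 𝒳}

lemma eventually_abs_logLik_sub_rate_le (hβ : 0 < β)
    (hN : Tendsto (fun n : ℕ => (n : ℝ) / (N n : ℝ)) atTop (𝓝 β)) (hA : A ⊆ fullSupport 𝒳)
    (hm : ∀ᶠ n in atTop, ∀ α ∈ configs A (N n), Meaningful c n α) (hp : ∀ i, p i < 1)
    (hx : ∀ i, Tendsto (fun n => (count (x n) i : ℝ) / n) atTop (𝓝 (p i))) {ε : ℝ} (hε : 0 < ε) :
    ∀ᶠ n in atTop, ∀ α ∈ configs A (N n),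
      |logLik c (N n) n (count (x n)) α -
        rate (n / N n) c (fun i => count (x n) i / n) (fun i => α i / N n)| ≤ ε := by
  have hcount : ∀ᶠ n in atTop, ∀ i, count (x n) i < n := by
    filter_upwards [eventually_all.2 fun i => (hx i).eventually_lt_const (hp i),
      eventually_gt_atTop 0] with n hxn hn i
    simpa using (div_lt_one (Nat.cast_pos.2 hn)).1 (hxn i)
  have herror : Tendsto (fun n : ℕ => Fintype.card 𝒳 * (Real.log (N n + n * |(c : ℝ)|) / n))
      atTop (𝓝 0) := by
    simpa using (tendsto_log_add_div hβ hN (abs_nonneg (c : ℝ))).const_mul (Fintype.card 𝒳 : ℝ)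
  filter_upwards [hm, hcount, eventually_pos_of_tendsto_div hβ hN, eventually_gt_atTop 0,
    herror.eventually_le_const hε] with n hmn hxn hNn hn hsmall α hα
  have hαpos := pos_of_mem_configs hA hα
  exact (abs_logLik_sub_rate_le hNn hn (mem_configs.1 hα).1 (sum_count (x n)) hαpos
    fun i => (hmn α hα).one_le (hαpos i) (hxn i)).trans hsmall

lemma eventually_logLik_le (hβ : 0 < β)
    (hN : Tendsto (fun n : ℕ => (n : ℝ) / (N n : ℝ)) atTop (𝓝 β)) (hA : A ⊆ fullSupport 𝒳)
    (hm : ∀ᶠ n in atTop, ∀ α ∈ configs A (N n), Meaningful c n α)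
    (hp : ∀ i, p i ∈ Set.Ioo 0 1)
    (hx : ∀ i, Tendsto (fun n => (count (x n) i : ℝ) / n) atTop (𝓝 (p i)))
    {s b : ℝ} (hs : ∀ q ∈ A, rate β c p q ≤ s) (hsb : s < b) :
    ∀ᶠ n in atTop, ∀ α ∈ configs A (N n), logLik c (N n) n (count (x n)) α ≤ b := by
  obtain ⟨b', hsb', hb'b⟩ := exists_between hsb
  filter_upwards [eventually_abs_logLik_sub_rate_le hβ hN hA hm (fun i => (hp i).2) hx
      (sub_pos.2 hb'b),
    (hN.prodMk_nhds (tendsto_pi_nhds.2 hx)).eventually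
      (eventually_forall_rate_le hβ.ne' c (fun i => (hp i).1) hs hsb')] with n herr hrate α hα
  obtain ⟨-, q, hq, hqα⟩ := mem_configs.1 hα
  have hle := hrate q hq
  rw [funext hqα] at hle
  linarith [(abs_le.1 (herr α hα)).2]

lemma exists_isOpen_eventually_le_logLik (hβ : 0 < β)
    (hN : Tendsto (fun n : ℕ => (n : ℝ) / (N n : ℝ)) atTop (𝓝 β)) (hA : A ⊆ fullSupport 𝒳)
    (hm : ∀ᶠ n in atTop, ∀ α ∈ configs A (N n), Meaningful c n α) (hp : ∀ i, p i < 1)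
    (hx : ∀ i, Tendsto (fun n => (count (x n) i : ℝ) / n) atTop (𝓝 (p i)))
    {q : stdSimplex ℝ 𝒳} (hq : q ∈ A) {b : ℝ} (hb : b < rate β c p q) :
    ∃ G : Set (stdSimplex ℝ 𝒳), IsOpen G ∧ q ∈ G ∧
      ∀ᶠ n in atTop, ∀ α ∈ configs (A ∩ G) (N n), b ≤ logLik c (N n) n (count (x n)) α := by
  obtain ⟨b', hbb', hb'q⟩ := exists_between hb
  have hcont : ContinuousAt
      (fun z : (ℝ × (𝒳 → ℝ)) × stdSimplex ℝ 𝒳 => rate z.1.1 c z.1.2 z.2) ((β, p), q) :=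
    ContinuousAt.comp' (x := ((β, p), q))
      (continuousAt_rate hβ.ne' c p fun i => (hA hq i).ne')
      (continuousAt_fst.fst.prodMk (continuousAt_fst.snd.prodMk
        (continuousAt_subtype_val.comp' continuousAt_snd)))
  obtain ⟨U, hU, V, hV, hUV⟩ := eventually_prod_iff.1
    (nhds_prod_eq (x := (β, p)) (y := q) ▸ hcont.eventually_const_lt hb'q)
  obtain ⟨G, hGV, hGo, hqG⟩ := eventually_nhds_iff.1 hV
  refine ⟨G, hGo, hqG, ?_⟩
  filter_upwards [eventually_abs_logLik_sub_rate_le hβ hN hA hm hp hx (sub_pos.2 hbb'),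
    (hN.prodMk_nhds (tendsto_pi_nhds.2 hx)).eventually hU] with n herr hUn α hα
  obtain ⟨-, q', hq', hqα⟩ := mem_configs.1 hα
  have hlt := hUV hUn (hGV q' hq'.2)
  rw [funext hqα] at hlt
  linarith [(abs_le.1 (herr α (configs_mono Set.inter_subset_left _ hα))).1]

variable {Φ Q : Set (stdSimplex ℝ 𝒳)}

lemma eventually_laplaceSum_logLik_pos (hβ : 0 < β)
    (hN : Tendsto (fun n : ℕ => (n : ℝ) / (N n : ℝ)) atTop (𝓝 β)) (hA : A ⊆ fullSupport 𝒳)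
    (hAo : IsOpen A) (hm : ∀ᶠ n in atTop, ∀ α ∈ configs A (N n), Meaningful c n α)
    (hπ : NotExpSmall π N A) (hp : ∀ i, p i < 1)
    (hx : ∀ i, Tendsto (fun n => (count (x n) i : ℝ) / n) atTop (𝓝 (p i))) {s : ℝ}
    (hs : IsLUB ((fun q : stdSimplex ℝ 𝒳 => rate β c p q) '' A) s) :
    ∀ᶠ n in atTop, 0 < laplaceSum (π n) (N n) n A (logLik c (N n) n (count (x n))) :=
  (eventually_exp_le_laplaceSum hAo hπ hs
    (fun _ hq _ => exists_isOpen_eventually_le_logLik hβ hN hA hm hp hx hq)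
    (sub_one_lt s)).mono fun _ hn => (Real.exp_pos _).trans_le hn

lemma tendsto_log_laplaceSum_logLik (hβ : 0 < β)
    (hN : Tendsto (fun n : ℕ => (n : ℝ) / (N n : ℝ)) atTop (𝓝 β)) (hA : A ⊆ fullSupport 𝒳)
    (hAo : IsOpen A) (hm : ∀ᶠ n in atTop, ∀ α ∈ configs A (N n), Meaningful c n α)
    (hπ : NotExpSmall π N A) (hp : ∀ i, p i ∈ Set.Ioo 0 1)
    (hx : ∀ i, Tendsto (fun n => (count (x n) i : ℝ) / n) atTop (𝓝 (p i))) {s : ℝ}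
    (hs : IsLUB ((fun q : stdSimplex ℝ 𝒳 => rate β c p q) '' A) s) :
    Tendsto (fun n : ℕ => 1 / (n : ℝ) *
      Real.log (laplaceSum (π n) (N n) n A (logLik c (N n) n (count (x n))))) atTop (𝓝 s) :=
  tendsto_log_laplaceSum hAo hπ hs
    (fun _ => eventually_logLik_le hβ hN hA hm hp hx fun q hq => hs.1 ⟨q, hq, rfl⟩)
    fun _ hq _ => exists_isOpen_eventually_le_logLik hβ hN hA hm (fun i => (hp i).2) hx hq

variable {Φ Q : Set (stdSimplex ℝ 𝒳)}

lemma tendsto_log_posterior (hβ : 0 < β)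
    (hN : Tendsto (fun n : ℕ => (n : ℝ) / (N n : ℝ)) atTop (𝓝 β))
    (hΦ : Φ ⊆ fullSupport 𝒳) (hΦo : IsOpen Φ) (hQΦ : Q ⊆ Φ) (hQo : IsOpen Q)
    (hm : ∀ᶠ n in atTop, ∀ α ∈ configs Φ (N n), Meaningful c n α) (hπ : NotExpSmall π N Φ)
    (hp : ∀ i, p i ∈ Set.Ioo 0 1)
    (hx : ∀ i, Tendsto (fun n => (count (x n) i : ℝ) / n) atTop (𝓝 (p i))) {sQ sΦ : ℝ}
    (hsQ : IsLUB ((fun q : stdSimplex ℝ 𝒳 => rate β c p q) '' Q) sQ)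
    (hsΦ : IsLUB ((fun q : stdSimplex ℝ 𝒳 => rate β c p q) '' Φ) sΦ) :
    (∀ᶠ n in atTop, 0 < posterior c (π n) (N n) Φ Q (x n)) ∧
      Tendsto (fun n : ℕ => 1 / (n : ℝ) * Real.log (posterior c (π n) (N n) Φ Q (x n))) atTop
        (𝓝 (sQ - sΦ)) := by
  have hp₁ : ∀ i, p i < 1 := fun i => (hp i).2
  have hQ := hQΦ.trans hΦ
  have hmQ := hm.mono fun n hmn α hα => hmn α (configs_mono hQΦ _ hα)
  have hπQ := hπ.mono hQΦ
  have hposΦ := eventually_laplaceSum_logLik_pos hβ hN hΦ hΦo hm hπ hp₁ hx hsΦ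
  have hposQ := eventually_laplaceSum_logLik_pos hβ hN hQ hQo hmQ hπQ hp₁ hx hsQ
  have hlimΦ := tendsto_log_laplaceSum_logLik hβ hN hΦ hΦo hm hπ hp hx hsΦ
  have hlimQ := tendsto_log_laplaceSum_logLik hβ hN hQ hQo hmQ hπQ hp hx hsQ
  have hpost : ∀ᶠ n in atTop, posterior c (π n) (N n) Φ Q (x n) =
      laplaceSum (π n) (N n) n Q (logLik c (N n) n (count (x n))) /
        laplaceSum (π n) (N n) n Φ (logLik c (N n) n (count (x n))) := by
    filter_upwards [hm, hposΦ, eventually_ne_atTop 0] with n hmn hpos hn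
    exact posterior_eq_laplaceSum_div hn hΦ hQΦ hmn (Finset.nonempty_of_sum_ne_zero hpos.ne') _
  refine ⟨?_, (hlimQ.sub hlimΦ).congr' ?_⟩
  · filter_upwards [hpost, hposQ, hposΦ] with n hn hnQ hnΦ
    exact hn ▸ div_pos hnQ hnΦ
  · filter_upwards [hpost, hposQ, hposΦ] with n hn hnQ hnΦ
    rw [hn, Real.log_div hnQ.ne' hnΦ.ne', mul_sub]

lemma tendsto_log_posterior_polyaLSet (hβ : 0 < β)
    (hN : Tendsto (fun n : ℕ => (n : ℝ) / (N n : ℝ)) atTop (𝓝 β))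
    (hΦ : Φ ⊆ fullSupport 𝒳) (hΦo : IsOpen Φ) (hQΦ : Q ⊆ Φ) (hQo : IsOpen Q) (hQ : Q.Nonempty)
    (hm : ∀ᶠ n in atTop, ∀ α ∈ configs Φ (N n), Meaningful c n α) (hπ : NotExpSmall π N Φ)
    {r : stdSimplex ℝ 𝒳} (hr : ∀ i, r i ∈ Set.Ioo 0 1)
    (hx : ∀ i, Tendsto (fun n => (count (x n) i : ℝ) / n) atTop (𝓝 (r i))) :
    (∀ᶠ n in atTop, 0 < posterior c (π n) (N n) Φ Q (x n)) ∧
      Tendsto (fun n : ℕ => ((1 / (n : ℝ) *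
        Real.log (posterior c (π n) (N n) Φ Q (x n)) : ℝ) : EReal)) atTop
        (𝓝 (-(polyaLSet β c Q r - polyaLSet β c Φ r))) := by
  have hL : ∀ q ∈ Φ, polyaL β c q r = -rate β c r q - 1 := fun q hq =>
    polyaL_eq hβ.ne' (hΦ hq) fun i => add_mul_pos_of_meaningful hβ hN hΦo hΦ hm hπ (hr i) hq
  have hlub : ∀ A : Set (stdSimplex ℝ 𝒳), A.Nonempty →
      ∃ s, IsLUB ((fun q : stdSimplex ℝ 𝒳 => rate β c r q) '' A) s := fun A hA =>
    Real.exists_isLUB (hA.image _)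
      ((bddAbove_range_rate hβ.ne' c fun i => (hr i).1.le).mono (Set.image_subset_range _ _))
  obtain ⟨sQ, hsQ⟩ := hlub Q hQ
  obtain ⟨sΦ, hsΦ⟩ := hlub Φ (hQ.mono hQΦ)
  obtain ⟨hpos, hlim⟩ := tendsto_log_posterior hβ hN hΦ hΦo hQΦ hQo hm hπ hr hx hsQ hsΦ
  refine ⟨hpos, ?_⟩
  rw [polyaLSet_eq (fun q hq => hL q (hQΦ hq)) hsQ, polyaLSet_eq hL hsΦ, ← EReal.coe_sub,
    ← EReal.coe_neg, EReal.tendsto_coe]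
  convert hlim using 2
  ring

lemma tendsto_log_posterior_of_subsingleton [Subsingleton 𝒳] (hΦ : Φ ⊆ fullSupport 𝒳)
    (hΦo : IsOpen Φ) (hQΦ : Q ⊆ Φ) (hQ : Q.Nonempty)
    (hm : ∀ᶠ n in atTop, ∀ α ∈ configs Φ (N n), Meaningful c n α) (hπ : NotExpSmall π N Φ)
    (r : stdSimplex ℝ 𝒳) (x : (n : ℕ) → Fin n → 𝒳) :
    (∀ᶠ n in atTop, 0 < posterior c (π n) (N n) Φ Q (x n)) ∧
      Tendsto (fun n : ℕ => ((1 / (n : ℝ) *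
        Real.log (posterior c (π n) (N n) Φ Q (x n)) : ℝ) : EReal)) atTop
        (𝓝 (-(polyaLSet β c Q r - polyaLSet β c Φ r))) := by
  have hsingle : ∀ A : Set (stdSimplex ℝ 𝒳), A.Nonempty → A = {r} := fun A hA =>
    Set.eq_singleton_iff_nonempty_unique_mem.2 ⟨hA, fun q _ => Subsingleton.elim q r⟩
  obtain rfl : Q = Φ := (hsingle Q hQ).trans (hsingle Φ (hQ.mono hQΦ)).symm
  have hpost : ∀ᶠ n in atTop, posterior c (π n) (N n) Q Q (x n) = 1 := by
    filter_upwards [hm, hπ.eventually_priorMass_pos hΦo hQ] with n hmn hpos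
    exact posterior_self hΦ hmn hpos (x n)
  have hL : polyaLSet β c Q r = (polyaL β c r r : EReal) := by
    rw [polyaLSet, hsingle Q hQ, iInf_singleton]
  refine ⟨hpost.mono fun n hn => hn ▸ one_pos, ?_⟩
  rw [hL, ← EReal.coe_sub, sub_self, EReal.coe_zero, neg_zero]
  refine tendsto_const_nhds.congr' (hpost.mono fun n hn => ?_)
  simp [hn]

end Posterior

end PolyaUrn

theorem theorem2p4_general {𝒳 : Type*} [Fintype 𝒳] [DecidableEq 𝒳]
    (c : ℤ) (β : ℝ) (hβ : 0 < β)
    (N : ℕ → ℕ) (hN : Tendsto (fun n : ℕ => (n : ℝ) / (N n : ℝ)) atTop (𝓝 β))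
    (Φ Q : Set (stdSimplex ℝ 𝒳))
    (hΦ : Φ ⊆ PolyaUrn.fullSupport 𝒳) (hΦo : IsOpen Φ) (hQΦ : Q ⊆ Φ) (hQo : IsOpen Q)
    (r : stdSimplex ℝ 𝒳) (hr : r ∈ PolyaUrn.fullSupport 𝒳)
    (rN : ℕ → 𝒳 → ℕ) (hrN : ∀ n, ∑ i, rN n i = N n)
    (hrlim : Tendsto
      (fun n => (1 / 2 : ℝ) * ∑ i, |(rN n i : ℝ) / (N n : ℝ) - (r : 𝒳 → ℝ) i|) atTop (𝓝 0))
    (hmr : ∀ᶠ n in atTop, PolyaUrn.Meaningful c n (rN n))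
    (hmΦ : ∀ᶠ n in atTop, ∀ α ∈ PolyaUrn.configs Φ (N n), PolyaUrn.Meaningful c n α)
    (π : ℕ → PMF (𝒳 → ℕ)) (hπ : PolyaUrn.NotExpSmall π N Φ)
    {Ω : Type*} [MeasurableSpace Ω] (μ : Measure Ω) [IsFiniteMeasure μ]
    (X : (n : ℕ) → Ω → Fin n → 𝒳)
    (hX : ∀ᶠ n in atTop, ∀ x : Fin n → 𝒳,
      μ.real (X n ⁻¹' {x}) = PolyaUrn.sampleProb c (rN n) x)
    (hL : PolyaUrn.polyaLSet β c Q r < ⊤) :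
    ∀ᵐ ω ∂μ,
      (∀ᶠ n in atTop, 0 < PolyaUrn.posterior c (π n) (N n) Φ Q (X n ω)) ∧
      Tendsto
        (fun n : ℕ => (((1 / (n : ℝ)) *
          Real.log (PolyaUrn.posterior c (π n) (N n) Φ Q (X n ω)) : ℝ) : EReal))
        atTop
        (𝓝 (-(PolyaUrn.polyaLSet β c Q r - PolyaUrn.polyaLSet β c Φ r))) := by
  have hQ : Q.Nonempty := PolyaUrn.polyaLSet_lt_top_iff.1 hL
  rcases subsingleton_or_nontrivial 𝒳 with _ | _
  · exact Eventually.of_forall fun ω =>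
      PolyaUrn.tendsto_log_posterior_of_subsingleton hΦ hΦo hQΦ hQ hmΦ hπ r (X · ω)
  · filter_upwards [PolyaUrn.ae_tendsto_count_div hβ hN hrN hmr
      (PolyaUrn.tendsto_of_tendsto_sum_abs_sub hrlim) hX] with ω hω
    exact PolyaUrn.tendsto_log_posterior_polyaLSet hβ hN hΦ hΦo hQΦ hQo hQ hmΦ hπ
      (PolyaUrn.mem_Ioo_of_mem_fullSupport hr) hω

theorem theorem2p4 {𝒳 : Type*} [Fintype 𝒳] [DecidableEq 𝒳]
    [MeasurableSpace 𝒳] [MeasurableSingletonClass 𝒳]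
    (c : ℤ) (β : ℝ) (hβ0 : 0 < β) (hβ1 : β < 1)
    -- the size of the urn from which the sample of size `n` is drawn
    (N : ℕ → ℕ) (hN : Tendsto (fun n : ℕ => (n : ℝ) / (N n : ℝ)) atTop (𝓝 β))
    -- the sets of proportions
    (Φ Q : Set (stdSimplex ℝ 𝒳))
    (hΦ : Φ ⊆ PolyaUrn.fullSupport 𝒳) (hΦo : IsOpen Φ) (hQΦ : Q ⊆ Φ) (hQo : IsOpen Q)
    -- the true initial configurations converge to `r` in total variation
    (r : stdSimplex ℝ 𝒳) (hr : r ∈ PolyaUrn.fullSupport 𝒳)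
    (rN : ℕ → 𝒳 → ℕ) (hrN : ∀ n, ∑ i, rN n i = N n)
    (hrlim : Tendsto
      (fun n => (1 / 2 : ℝ) * ∑ i, |(rN n i : ℝ) / (N n : ℝ) - (r : 𝒳 → ℝ) i|) atTop (𝓝 0))
    -- sampling is meaningful for the true configuration and for the model
    (hmr : ∀ᶠ n in atTop, PolyaUrn.Meaningful c n (rN n))
    (hmΦ : ∀ᶠ n in atTop, ∀ α ∈ PolyaUrn.configs Φ (N n), PolyaUrn.Meaningful c n α)
    -- the priors: their support is `Φ(N)`, and no nonempty open part of `Φ` has exponentially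
    -- small prior probability
    (π : ℕ → PMF (𝒳 → ℕ))
    (hπ : ∀ᶠ n in atTop, (π n).support = (PolyaUrn.configs Φ (N n) : Set (𝒳 → ℕ)))
    (hπ' : ∀ G ⊆ Φ, IsOpen G → G.Nonempty → ∀ ε : ℝ, 0 < ε →
      ∀ᶠ n : ℕ in atTop, Real.exp (-(ε * n)) ≤ PolyaUrn.priorMass (π n) (N n) G)
    -- the samples, with an arbitrary joint distribution for different `n`
    {Ω : Type*} [MeasurableSpace Ω] (μ : Measure Ω) [IsProbabilityMeasure μ]
    (X : (n : ℕ) → Ω → Fin n → 𝒳) (hXm : ∀ n, Measurable (X n))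
    (hX : ∀ᶠ n in atTop, ∀ x : Fin n → 𝒳,
      μ.real (X n ⁻¹' {x}) = PolyaUrn.sampleProb c (rN n) x)
    (hL : PolyaUrn.polyaLSet β c Q r < ⊤) :
    ∀ᵐ ω ∂μ,
      (∀ᶠ n in atTop, 0 < PolyaUrn.posterior c (π n) (N n) Φ Q (X n ω)) ∧
      Tendsto
        (fun n : ℕ => (((1 / (n : ℝ)) *
          Real.log (PolyaUrn.posterior c (π n) (N n) Φ Q (X n ω)) : ℝ) : EReal))
        atTop
        (𝓝 (-(PolyaUrn.polyaLSet β c Q r - PolyaUrn.polyaLSet β c Φ r))) :=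
  theorem2p4_general c β hβ0 N hN Φ Q hΦ hΦo hQΦ hQo r hr rN hrN hrlim hmr hmΦ π hπ' μ X hX hL
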